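/- Let $M$ be a complex manifold of complex dimension $n$ with a Kähler form $\omega$ and a nowhere vanishing holomorphic $(n,0)$-form $\varphi$. Let $g(u,v)=\omega(u,Jv)$ be the Kähler metric and let $g'=c\,g$, with $c>0$ a function on $M$, be the conformal metric with respect to which $\varphi$ has pointwise length $(\sqrt2)^n$ (so $g'=g$ if $\varphi$ already has this length, as for a normalized Calabi–Yau metric). Let $L$ be a compact smooth $n$-manifold. A smooth embedding $i:L\to M$ is called special Lagrangian if $i^*\omega=0$ and $i^*\operatorname{Im}\varphi=0$. For an open set $U\subseteq M$ let $\mathcal M_U$ be the moduli space of special Lagrangian submanifolds of type $L$ contained in $U$, that is, the set of special Lagrangian embeddings of $L$ with image in $U$ modulo diffeomorphisms of $L$, with the quotient of the $C^\infty$ topology. Let $L_0$ be a special Lagrangian submanifold of type $L$ and let $f$ be a holomorphic function on an open neighbourhood $U$ of $L_0$. For every special Lagrangian submanifold $L'\subset U$ of type $L$ the function $f|_{L'}$ is integrable with respect to the Riemannian volume of the metric induced by $g'$ on $L'$; put $\xi(L')=\int_{L'} f\,d\mathrm{vol}_{g'}$. Then $\xi$ is constant on the connected component of $L_0$ in $\mathcal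 M_U$. -/

import Mathlib

open scoped Manifold ContDiff
open MeasureTheory Set

noncomputable section

namespace SLag

/-- Expression of a field `β` of alternating forms on `M` in the chart `e`: the pullback of `β`
by `e⁻¹`, an `E`-form on the target of `e`. -/
def chartForm {𝕜 : Type*} [NontriviallyNormedField 𝕜] {E : Type*} [NormedAddCommGroup E]
    [NormedSpace 𝕜 E] {F : Type*} [NormedAddCommGroup F] [NormedSpace 𝕜 F]
    {M : Type*} [TopologicalSpace M] [ChartedSpace E M] {k : ℕ}
    (β : ∀ p : M, TangentSpace 𝓘(𝕜, E) p [⋀^Fin k]→L[𝕜] F)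
    (e : OpenPartialHomeomorph M E) : E → E [⋀^Fin k]→L[𝕜] F :=
  fun x => (β (e.symm x)).compContinuousLinearMap (mfderiv 𝓘(𝕜, E) 𝓘(𝕜, E) e.symm x)

/-- A Kähler form together with a holomorphic volume form on a complex manifold `M` modelled on the
complex vector space `E` of dimension `n`. A form of type `(n, 0)` is a field of complex multilinear
alternating forms; holomorphic means complex analytic in the charts. The complex structure of
the tangent spaces is multiplication by `Complex.I`. -/
structure CalabiYau (n : ℕ) (E : Type*) [NormedAddCommGroup E] [NormedSpace ℂ E]
    (M : Type*) [TopologicalSpace M] [ChartedSpace E M] where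
  /-- the Kähler form -/
  kahler : ∀ p : M, TangentSpace 𝓘(ℝ, E) p [⋀^Fin 2]→L[ℝ] ℝ
  kahler_smooth : ∀ e ∈ atlas E M, ContDiffOn ℝ ∞ (chartForm kahler e) e.target
  kahler_closed : ∀ e ∈ atlas E M, ∀ x ∈ e.target, extDeriv (chartForm kahler e) x = 0
  kahler_invariant : ∀ (p : M) (u v : E),
    kahler p ![Complex.I • u, Complex.I • v] = kahler p ![u, v]
  kahler_pos : ∀ (p : M) (u : E), u ≠ 0 → 0 < kahler p ![u, Complex.I • u]
  /-- the holomorphic volume form -/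
  vol : ∀ p : M, TangentSpace 𝓘(ℂ, E) p [⋀^Fin n]→L[ℂ] ℂ
  vol_holomorphic : ∀ e ∈ atlas E M, ContDiffOn ℂ ω (chartForm vol e) e.target
  vol_ne_zero : ∀ p : M, vol p ≠ 0

/-- The inner product `g` on a real vector space of dimension `2 n` gives the complex valued
`n`-form `α` the length `ℓ`: for orthonormal frames `e` one has
`∑_{s₁ < ⋯ < sₙ} |α (e_{s₁}, …, e_{sₙ})|² = ℓ²`, where the sum over increasing indices
is written as `1 / n!` times the sum over all indices. -/
def HasLength {n : ℕ} {V : Type*} (g : V → V → ℝ) (α : (Fin n → V) → ℂ) (ℓ : ℝ) : Prop :=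
  0 ≤ ℓ ∧ ∀ e : Fin n × Fin 2 → V, (∀ a b, g (e a) (e b) = if a = b then 1 else 0) →
    (∑ s : Fin n → Fin n × Fin 2, ‖α (fun k => e (s k))‖ ^ 2) / (n.factorial : ℝ) = ℓ ^ 2

section

variable {n : ℕ} {E : Type*} [NormedAddCommGroup E] [NormedSpace ℂ E]
  {M : Type*} [TopologicalSpace M] [ChartedSpace E M]

/-- The Kähler metric `g(u, v) = ω(u, J v)`. -/
def CalabiYau.metric (X : CalabiYau n E M) (p : M) (u v : E) : ℝ :=
  X.kahler p ![u, Complex.I • v]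

/-- `c g` is the conformal change of the Kähler metric `g` with respect to which
the holomorphic volume form has length `(√2)ⁿ`. -/
def CalabiYau.IsNormalizing (X : CalabiYau n E M) (c : M → ℝ) : Prop :=
  ∀ p, 0 < c p ∧ HasLength (fun u v : E => c p * X.metric p u v) (fun v => X.vol p v) (√2 ^ n)

/-- Special Lagrangian embeddings of the `n`-manifold `L` into `M` with image in `U`. -/
structure SLagEmbedding (X : CalabiYau n E M) (L : Type*) [TopologicalSpace L]
    [ChartedSpace (EuclideanSpace ℝ (Fin n)) L] (U : Set M) where
  toMap : C^∞⟮𝓡 n, L; 𝓘(ℝ, E), M⟯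
  isSmoothEmbedding : Manifold.IsSmoothEmbedding (𝓡 n) 𝓘(ℝ, E) ∞ toMap
  lagrangian : ∀ (q : L) (u v : TangentSpace (𝓡 n) q),
    X.kahler (toMap q) ![mfderiv (𝓡 n) 𝓘(ℝ, E) toMap q u, mfderiv (𝓡 n) 𝓘(ℝ, E) toMap q v] = 0
  special : ∀ (q : L) (v : Fin n → TangentSpace (𝓡 n) q),
    (X.vol (toMap q) (fun k => mfderiv (𝓡 n) 𝓘(ℝ, E) toMap q (v k))).im = 0
  range_subset : range toMap ⊆ U

variable {L : Type*} [TopologicalSpace L] [ChartedSpace (EuclideanSpace ℝ (Fin n)) L]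

variable (n E M L) in
/-- The `C^∞` topology on smooth maps `L → M`, `L` compact: the subbasic open sets consist of the
maps whose expressions in charts have derivatives up to order `k` within `ε` of those
of a given map, uniformly on a compact set `K` in the domain of a chart of `L`. -/
@[reducible] def smoothTopology : TopologicalSpace C^∞⟮𝓡 n, L; 𝓘(ℝ, E), M⟯ :=
  .generateFrom {N | ∃ f : C^∞⟮𝓡 n, L; 𝓘(ℝ, E), M⟯,
    ∃ e ∈ atlas (EuclideanSpace ℝ (Fin n)) L, ∃ e' ∈ atlas E M, ∃ K : Set L, ∃ k : ℕ, ∃ ε > (0 : ℝ),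
      IsCompact K ∧ K ⊆ e.source ∧ MapsTo f K e'.source ∧
      N = {h : C^∞⟮𝓡 n, L; 𝓘(ℝ, E), M⟯ | MapsTo h K e'.source ∧ ∀ m ≤ k, ∀ q ∈ K,
        ‖iteratedFDeriv ℝ m (e' ∘ h ∘ e.symm) (e q)
          - iteratedFDeriv ℝ m (e' ∘ f ∘ e.symm) (e q)‖ < ε}}

instance (X : CalabiYau n E M) (U : Set M) : TopologicalSpace (SLagEmbedding X L U) :=
  .induced SLagEmbedding.toMap (smoothTopology n E M L)

/-- Embeddings that differ by a diffeomorphism of `L`. -/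
instance reparametrization (X : CalabiYau n E M) (U : Set M) : Setoid (SLagEmbedding X L U) where
  r i j := ∃ ψ : Diffeomorph (𝓡 n) (𝓡 n) L L ∞, ∀ q, j.toMap q = i.toMap (ψ q)
  iseqv :=
    { refl := fun _ => ⟨Diffeomorph.refl _ _ _, fun _ => rfl⟩
      symm := by
        rintro i j ⟨ψ, h⟩
        exact ⟨ψ.symm, fun q => by simp [h]⟩
      trans := by
        rintro i j k ⟨ψ, h⟩ ⟨χ, h'⟩
        exact ⟨χ.trans ψ, fun q => by simp [h, h']⟩ }

variable (L) in
/-- The moduli space of special Lagrangian submanifolds of `M` which lie in `U` and are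
diffeomorphic to `L`: special Lagrangian embeddings of `L` modulo diffeomorphisms of `L`,
with the quotient of the `C^∞` topology. -/
abbrev Moduli (X : CalabiYau n E M) (U : Set M) : Type _ :=
  Quotient (reparametrization (L := L) X U)

/-- The Riemannian metric that the embedding `i` induces on `L` from the metric `c g` on `M`. -/
def SLagEmbedding.inducedMetric {X : CalabiYau n E M} {U : Set M} (i : SLagEmbedding X L U)
    (c : M → ℝ) (q : L) (u v : TangentSpace (𝓡 n) q) : ℝ :=
  c (i.toMap q) * X.metric (i.toMap q)
    (mfderiv (𝓡 n) 𝓘(ℝ, E) i.toMap q u) (mfderiv (𝓡 n) 𝓘(ℝ, E) i.toMap q v)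

/-- The Riemannian density `√det (G (∂ⱼ, ∂ₖ))` in the chart `e`. -/
def chartDensity (G : ∀ q : L, TangentSpace (𝓡 n) q → TangentSpace (𝓡 n) q → ℝ)
    (e : OpenPartialHomeomorph L (EuclideanSpace ℝ (Fin n))) (x : EuclideanSpace ℝ (Fin n)) : ℝ :=
  √(Matrix.det (Matrix.of fun j k : Fin n => G (e.symm x)
    (mfderiv (𝓡 n) (𝓡 n) e.symm x (EuclideanSpace.single j (1 : ℝ)))
    (mfderiv (𝓡 n) (𝓡 n) e.symm x (EuclideanSpace.single k (1 : ℝ)))))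

variable (n L) in
/-- A smooth partition of unity on `L` subordinate to the charts. -/
def chartPartition [T2Space L] [CompactSpace L] [IsManifold (𝓡 n) ∞ L] :
    SmoothPartitionOfUnity L (𝓡 n) L univ :=
  Classical.choose (SmoothPartitionOfUnity.exists_isSubordinate_chartAt_source (𝓡 n) L)

/-- The Riemannian volume measure on `L` of the metric `G`: in each chart, Lebesgue measure with
density `√det (G (∂ⱼ, ∂ₖ))`, the charts being glued by a partition of unity (the result does not
depend on it). -/
def riemannianVolume [T2Space L] [CompactSpace L] [IsManifold (𝓡 n) ∞ L]
    [MeasurableSpace L] [BorelSpace L]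
    (G : ∀ q : L, TangentSpace (𝓡 n) q → TangentSpace (𝓡 n) q → ℝ) : Measure L :=
  Measure.sum fun p : L =>
    (((volume : Measure (EuclideanSpace ℝ (Fin n))).restrict
      (chartAt (EuclideanSpace ℝ (Fin n)) p).target).withDensity fun x =>
        ENNReal.ofReal (chartPartition n L p ((chartAt (EuclideanSpace ℝ (Fin n)) p).symm x)
          * chartDensity G (chartAt (EuclideanSpace ℝ (Fin n)) p) x)).map
      (chartAt (EuclideanSpace ℝ (Fin n)) p).symm

end

end SLag

end

noncomputable section

namespace SLag

/-! ### Linear algebra of Lagrangian frames and complex volume forms. -/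

section LinearAlgebra

/-! Special Lagrangian submanifolds are calibrated: on a Lagrangian tangent space the density of
`g'` is the absolute value of `φ`, thanks to the normalization of the length of `φ`
(`det_gram_eq_norm_sq`, `SLagEmbedding.chartDensity_inducedMetric`), and `φ` is real there. So
`ξ(L')` is, up to orientation, the integral over `L'` of `f φ`. Locally `f φ = F A` with `F`
holomorphic and `A` a constant complex form of top degree. This form is closed, because there is no
nonzero form of type `(n+1, 0)`; the algebraic content is Cramer's rule, `sum_apply_mul_update`.
Hence its integral does not change under deformation.

No orientation of `L` is used. Near a fixed special Lagrangian embedding `u`, the pullback of `φ` by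
a smooth map `h` is divided by the pullback by `u`; the quotient is a function on `L`, and
`relativeIntegrand` is `f ∘ h` times it, to be integrated against the volume of `u`. If `h` is
special Lagrangian and `C¹`-close to `u`, the quotient is real and positive
(`SLagEmbedding.eventually_ratio_pos`), so this integral is `ξ(h)`.

Stokes' theorem is replaced by a local homotopy argument. Inside a convex piece of a chart of `M`,
with the map fixed outside a compact set, the derivative of the integrand along the linear homotopy
is a divergence with compact support (`setIntegral_pullback_sub_eq_zero`). Finitely many such local
moves turn `u` into any nearby map (`exists_isConstantFamily`), so the integral is locally constant
on embeddings (`SLagEmbedding.eventually_integral_eq`). It is invariant under diffeomorphisms of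
`L`, hence gives a locally constant function on the quotient, and such a function is constant on
connected components. -/

theorem update_pair_zero {F : Type*} (u v x : F) : Function.update ![u, v] 0 x = ![x, v] := by
  funext k; fin_cases k <;> simp

theorem update_pair_one {F : Type*} (u v x : F) : Function.update ![u, v] 1 x = ![u, x] := by
  funext k; fin_cases k <;> simp

variable {n : ℕ} {E : Type*} [NormedAddCommGroup E] [NormedSpace ℂ E]

theorem alternatingMap_sum_smul (φ : E [⋀^Fin n]→L[ℂ] ℂ) (e : Fin n → E)
    (A : Matrix (Fin n) (Fin n) ℂ) :
    φ (fun j => ∑ k, A j k • e k) = A.det * φ e := by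
  have h := AlternatingMap.eq_smul_basis_det (Pi.basisFun ℂ (Fin n))
    (φ.toAlternatingMap.compLinearMap (Fintype.linearCombination ℂ e))
  have h2 : φ (fun j => ∑ k, A j k • e k) =
      φ (fun i => ∑ k, (Pi.single i 1 : Fin n → ℂ) k • e k) *
        (Pi.basisFun ℂ (Fin n)).det (fun j => A j) := by
    have := congrArg (fun f => f (fun j => A j)) h
    simpa [Function.comp_def, Fintype.linearCombination_apply] using this
  rw [h2, mul_comm, Pi.basisFun_det_apply]
  congr 2
  funext k
  rw [Finset.sum_eq_single k]
  · simp
  · intro b _ hb; simp [hb]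
  · simp

/-- Evaluates the sum in `HasLength` on the real frame `(e, i e)`. Complex multilinearity extracts
factors `1` or `i` of modulus one, so each choice of the `e`-indices occurs `2 ^ n` times; only the
`n!` permutations survive, each up to sign. -/
theorem sum_norm_sq_frame (φ : E [⋀^Fin n]→L[ℂ] ℂ) (e : Fin n → E) :
    ∑ s : Fin n → Fin n × Fin 2,
      ‖φ (fun k => (if (s k).2 = 0 then (1 : ℂ) else Complex.I) • e (s k).1)‖ ^ 2 =
      n.factorial * (2 ^ n * ‖φ e‖ ^ 2) := by
  have h1 : ∀ s : Fin n → Fin n × Fin 2,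
      ‖φ (fun k => (if (s k).2 = 0 then (1 : ℂ) else Complex.I) • e (s k).1)‖ ^ 2 =
      ‖φ (fun k => e (s k).1)‖ ^ 2 := by
    intro s
    have := φ.toContinuousMultilinearMap.map_smul_univ
      (fun k => if (s k).2 = 0 then (1 : ℂ) else Complex.I) (fun k => e (s k).1)
    simp only [ContinuousAlternatingMap.coe_toContinuousMultilinearMap] at this
    rw [this, norm_smul, norm_prod, Finset.prod_eq_one, one_mul]
    intro k _
    split_ifs <;> simp
  simp_rw [h1]
  have h0 := Fintype.sum_equiv
    (Equiv.arrowProdEquivProdArrow (Fin n) (fun _ => Fin n) (fun _ => Fin 2))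
    (fun s => ‖φ (fun k => e (s k).1)‖ ^ 2)
    (fun p => ‖φ (fun k => e (p.1 k))‖ ^ 2) (fun s => rfl)
  rw [h0, Fintype.sum_prod_type]
  simp only [Finset.sum_const, Finset.card_univ, Fintype.card_fun, Fintype.card_fin, nsmul_eq_mul]
  rw [← Finset.mul_sum]
  have h2 : ∑ i : Fin n → Fin n, ‖φ (fun k => e (i k))‖ ^ 2 =
      ∑ σ : Equiv.Perm (Fin n), ‖φ e‖ ^ 2 := by
    symm
    refine Finset.sum_of_injOn (fun σ => ⇑σ) (fun a _ b _ h => DFunLike.coe_injective h)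
      (by simp) ?_ ?_
    · intro a _ ha
      have : ¬ Function.Injective a := by
        intro hi
        exact ha ⟨Equiv.ofBijective a (Finite.injective_iff_bijective.1 hi), by simp, rfl⟩
      rw [Function.Injective] at this
      push Not at this
      obtain ⟨i, j, hij, hne⟩ := this
      rw [φ.map_eq_zero_of_eq _ (by simp [hij]) hne]
      simp
    · intro σ _
      have := φ.toAlternatingMap.map_perm e σ
      simp only [ContinuousAlternatingMap.coe_toAlternatingMap, Function.comp_def] at this
      rw [this]
      rcases Int.units_eq_one_or (Equiv.Perm.sign σ) with h | h <;> simp [h]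
  rw [h2]
  simp [Fintype.card_perm]
  ring

theorem form_swap (w : E [⋀^Fin 2]→L[ℝ] ℝ) (u v : E) : w ![v, u] = - w ![u, v] := by
  have := w.toAlternatingMap.map_swap ![u, v] (i := 0) (j := 1) (by simp)
  simp only [ContinuousAlternatingMap.coe_toAlternatingMap] at this
  rw [← this]
  congr 1
  funext k
  fin_cases k <;> simp

/-- The bilinear form underlying an alternating `2`-form. -/
def formBilin (w : E [⋀^Fin 2]→L[ℝ] ℝ) : LinearMap.BilinForm ℝ E :=
  LinearMap.mk₂ ℝ (fun u v => w ![u, v])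
    (fun u u' v => by
      simpa only [update_pair_zero] using w.map_update_add ![u, v] 0 u u')
    (fun c u v => by
      simpa only [update_pair_zero] using w.map_update_smul ![u, v] 0 c u)
    (fun u v v' => by
      simpa only [update_pair_one] using w.map_update_add ![u, v] 1 v v')
    (fun c u v => by
      simpa only [update_pair_one] using w.map_update_smul ![u, v] 1 c v)

theorem formBilin_apply (w : E [⋀^Fin 2]→L[ℝ] ℝ) (u v : E) : formBilin w u v = w ![u, v] := rfl

/-- A Lagrangian frame spans a parallelepiped of volume `‖φ v‖`, for a normalized
complex volume form `φ`. -/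
theorem det_gram_eq_norm_sq (w : E [⋀^Fin 2]→L[ℝ] ℝ)
    (hinv : ∀ u v : E, w ![Complex.I • u, Complex.I • v] = w ![u, v])
    (hpos : ∀ u : E, u ≠ 0 → 0 < w ![u, Complex.I • u])
    (φ : E [⋀^Fin n]→L[ℂ] ℂ) {c : ℝ} (hc : 0 < c)
    (hlen : HasLength (fun u v : E => c * w ![u, Complex.I • v]) (fun v => φ v) (√2 ^ n))
    (v : Fin n → E) (hlag : ∀ j k, w ![v j, v k] = 0) (hli : LinearIndependent ℝ v) :
    (Matrix.of fun j k => c * w ![v j, Complex.I • v k]).det = ‖φ v‖ ^ 2 := by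
  set J : E →ₗ[ℝ] E := (LinearMap.lsmul ℂ E Complex.I).restrictScalars ℝ with hJ
  have hJ_apply : ∀ u, J u = Complex.I • u := fun u => rfl
  set g : LinearMap.BilinForm ℝ E := c • (formBilin w).compl₂ J with hg
  have hg_apply : ∀ u v, g u v = c * w ![u, Complex.I • v] := fun u v => rfl
  have hII : ∀ u : E, Complex.I • Complex.I • u = -u := by
    intro u; rw [smul_smul, Complex.I_mul_I, neg_one_smul]
  have hneg : ∀ u v : E, w ![u, -v] = - w ![u, v] := fun u v => by
    rw [← formBilin_apply, map_neg, formBilin_apply]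
  have hsymm : ∀ u v, g u v = g v u := by
    intro u v
    rw [hg_apply, hg_apply, ← hinv v, hII, hneg, form_swap w u, neg_neg]
  set G : Matrix (Fin n) (Fin n) ℝ := Matrix.of fun j k => c * w ![v j, Complex.I • v k] with hG
  have hG_apply : ∀ j k, G j k = g (v j) (v k) := fun j k => rfl
  have hGpos : G.PosDef := by
    refine Matrix.PosDef.of_dotProduct_mulVec_pos ?_ ?_
    · ext j k
      simp [hG_apply, hsymm]
    · intro x hx
      have hu : ∑ i, x i • v i ≠ 0 := by
        intro h0
        exact hx (funext (Fintype.linearIndependent_iff.1 hli x h0))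
      have : star x ⬝ᵥ G.mulVec x = g (∑ i, x i • v i) (∑ i, x i • v i) := by
        simp only [dotProduct, Matrix.mulVec, map_sum, LinearMap.sum_apply, map_smul,
          LinearMap.smul_apply, smul_eq_mul, hG_apply, Finset.mul_sum]
        rw [Finset.sum_comm]
        simp only [star_trivial]
        refine Finset.sum_congr rfl fun i _ => Finset.sum_congr rfl fun j _ => ?_
        ring
      rw [this, hg_apply]
      exact mul_pos hc (hpos _ hu)
  -- Factoring the Gram matrix this way orthonormalizes the frame: the columns of `B⁻¹` give the new
  -- vectors.
  obtain ⟨B, hB⟩ : ∃ B : Matrix (Fin n) (Fin n) ℝ, G = B.transpose * B := by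
    open scoped MatrixOrder Matrix.Norms.L2Operator in
    obtain ⟨B, hB⟩ := CStarAlgebra.nonneg_iff_eq_star_mul_self.1 hGpos.posSemidef.nonneg
    exact ⟨B, by simpa [Matrix.star_eq_conjTranspose, Matrix.conjTranspose_eq_transpose_of_trivial] using hB⟩
  have hdet : G.det = B.det ^ 2 := by rw [hB, Matrix.det_mul, Matrix.det_transpose, sq]
  have hBu : IsUnit B.det := by
    rw [isUnit_iff_ne_zero]
    intro h0
    have := hGpos.det_pos
    rw [hdet, h0] at this
    simp at this
  set C := B⁻¹ with hC
  set e : Fin n → E := fun k => ∑ j, C j k • v j with he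
  have hge : ∀ k l, g (e k) (e l) = if k = l then 1 else 0 := by
    intro k l
    have h1 : C.transpose * G * C = 1 := by
      rw [hB, Matrix.mul_assoc, Matrix.mul_assoc, Matrix.mul_nonsing_inv _ hBu, Matrix.mul_one,
        ← Matrix.transpose_mul, Matrix.mul_nonsing_inv _ hBu, Matrix.transpose_one]
    have h2 := congrFun (congrFun h1 k) l
    rw [Matrix.one_apply] at h2
    rw [← h2]
    simp only [he, map_sum, LinearMap.sum_apply, map_smul,
          LinearMap.smul_apply, smul_eq_mul, Matrix.mul_apply, Matrix.transpose_apply, hG_apply,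
          Finset.sum_mul, Finset.mul_sum]
    refine Finset.sum_congr rfl fun i _ => Finset.sum_congr rfl fun j _ => ?_
    ring
  have hlage : ∀ k l, w ![e k, e l] = 0 := by
    intro k l
    rw [← formBilin_apply]
    simp [he, map_sum, LinearMap.sum_apply, formBilin_apply, hlag]
  have hve : v = fun j => ∑ k, (B.map Complex.ofReal).transpose j k • e k := by
    funext j
    have h1 : C * B = 1 := Matrix.nonsing_inv_mul _ hBu
    have h3 : ∀ i, ∑ k, B k j * C i k = if i = j then 1 else 0 := by
      intro i
      have h2 := congrFun (congrFun h1 i) j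
      rw [Matrix.one_apply, Matrix.mul_apply] at h2
      rw [← h2]
      exact Finset.sum_congr rfl fun k _ => mul_comm _ _
    simp only [Matrix.transpose_apply, Matrix.map_apply, Complex.coe_smul, he, Finset.smul_sum,
      smul_smul]
    rw [Finset.sum_comm]
    simp_rw [← Finset.sum_smul, h3]
    simp
  -- The vectors `e` together with `i e` are orthonormal for `c g`: the mixed products are values of
  -- `w` on pairs from `e`, which vanish because the frame is Lagrangian. The normalization then
  -- forces `‖φ e‖ = 1`, and `φ v` differs from `φ e` by the factor `det B`.
  have hlen2 := hlen.2 (fun a => (if a.2 = 0 then (1 : ℂ) else Complex.I) • e a.1) (by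
    rintro ⟨j, b⟩ ⟨k, b'⟩
    have hgj : ∀ j k, c * w ![e j, Complex.I • e k] = if j = k then 1 else 0 := hge
    fin_cases b <;> fin_cases b'
    · simp [hgj]
    · simp [hII, hneg, hlage]
    · simp [hinv, hlage]
    · simp [hinv, hgj])
  rw [sum_norm_sq_frame] at hlen2
  have hφe : ‖φ e‖ ^ 2 = 1 := by
    have h2 : (√2 ^ n) ^ 2 = (2 : ℝ) ^ n := by
      rw [← pow_mul, mul_comm, pow_mul, Real.sq_sqrt (by norm_num)]
    rw [h2, mul_div_cancel_left₀ _ (by positivity)] at hlen2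
    have : (2 : ℝ) ^ n ≠ 0 := by positivity
    exact (mul_eq_left₀ this).1 hlen2
  rw [hdet]
  conv_rhs => rw [hve]
  rw [alternatingMap_sum_smul, Matrix.det_transpose, norm_mul, mul_pow, hφe, mul_one]
  have h5 : (B.map Complex.ofReal).det = ((B.det : ℝ) : ℂ) := by
    exact (RingHom.map_det Complex.ofRealHom B).symm
  rw [h5, Complex.norm_real, Real.norm_eq_abs, sq_abs]

/-- The volume form does not vanish on Lagrangian frames. -/
theorem volume_form_ne_zero (w : E [⋀^Fin 2]→L[ℝ] ℝ)
    (hpos : ∀ u : E, u ≠ 0 → 0 < w ![u, Complex.I • u]) [FiniteDimensional ℂ E]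
    (hE : Module.finrank ℂ E = n) (φ : E [⋀^Fin n]→L[ℂ] ℂ) (hφ : φ ≠ 0)
    (v : Fin n → E) (hlag : ∀ j k, w ![v j, v k] = 0) (hli : LinearIndependent ℝ v) :
    φ v ≠ 0 := by
  have hneg : ∀ u v : E, w ![u, -v] = - w ![u, v] := fun u v => by
    rw [← formBilin_apply, map_neg, formBilin_apply]
  -- A complex relation reads `a + i b = 0` with `a`, `b` in the real span of `v`. Then `w(b, i b) =
  -- -w(b, a) = 0`, so positivity gives `b = 0`, whence `a = 0`.
  have hliC : LinearIndependent ℂ v := by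
    rw [Fintype.linearIndependent_iff]
    intro z hz
    set a : E := ∑ i, (z i).re • v i
    set b : E := ∑ i, (z i).im • v i
    have hab : a + Complex.I • b = 0 := by
      rw [← hz, Finset.smul_sum, ← Finset.sum_add_distrib]
      refine Finset.sum_congr rfl fun i _ => ?_
      conv_rhs => rw [← Complex.re_add_im (z i)]
      rw [add_smul, Complex.coe_smul, mul_comm, mul_smul, Complex.coe_smul]
    have hw : w ![b, a] = 0 := by
      rw [← formBilin_apply]
      simp [a, b, map_sum, LinearMap.sum_apply, formBilin_apply, hlag]
    have hb : b = 0 := by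
      by_contra hb
      have := hpos b hb
      rw [show Complex.I • b = -a from eq_neg_of_add_eq_zero_right hab, hneg, hw] at this
      simp at this
    have ha : a = 0 := by simpa [hb] using hab
    intro i
    exact Complex.ext (Fintype.linearIndependent_iff.1 hli _ ha i)
      (Fintype.linearIndependent_iff.1 hli _ hb i)
  intro h0
  apply hφ
  have hcard : Fintype.card (Fin n) = Module.finrank ℂ E := by simp [hE]
  -- Constructing a basis from an independent family needs a nonempty index type; for `n = 0` there
  -- is only the empty tuple.
  by_cases hn : n = 0
  · subst hn
    ext u
    rw [Subsingleton.elim u v, h0]; rfl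
  have : Nonempty (Fin n) := ⟨⟨0, Nat.pos_of_ne_zero hn⟩⟩
  let bas := basisOfLinearIndependentOfCardEqFinrank hliC hcard
  have hb : ⇑bas = v := by simp [bas]
  ext u
  have h2 := AlternatingMap.eq_smul_basis_det bas φ.toAlternatingMap
  have h3 := congrArg (fun f => f u) h2
  simp only [hb, ContinuousAlternatingMap.coe_toAlternatingMap] at h3
  rw [h3, h0]; simp

/-- Cramer's rule for top degree forms. -/
theorem sum_apply_mul_update [FiniteDimensional ℂ E] (hE : Module.finrank ℂ E = n)
    (φ : E [⋀^Fin n]→L[ℂ] ℂ) (l : E →L[ℂ] ℂ) (v : Fin n → E) (w : E) :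
    ∑ k, l (v k) * φ (Function.update v k w) = l w * φ v := by
  let bas := (Module.finBasis ℂ E).reindex (finCongr hE)
  have h2 : ∀ u, φ u = φ bas * (bas.toMatrix u).det := by
    intro u
    have h2 := congrArg (fun f => f u) (AlternatingMap.eq_smul_basis_det bas φ.toAlternatingMap)
    simpa [Module.Basis.det_apply] using h2
  have h4 : ∀ k, (bas.toMatrix (Function.update v k w)).det =
      (bas.toMatrix v).cramer (bas.repr w) k := by
    intro k
    rw [Matrix.cramer_apply, Module.Basis.toMatrix_update]
  have h5 := Matrix.mulVec_cramer (bas.toMatrix v) (bas.repr w)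
  -- Cramer's rule in vector form. Applying `l` to it expresses that `l ∧ φ`, of degree `n + 1` in
  -- dimension `n`, is zero.
  have h6 : ∑ k, (bas.toMatrix v).cramer (bas.repr w) k • v k = (bas.toMatrix v).det • w := by
    apply bas.repr.injective
    ext i
    have := congrFun h5 i
    simp only [map_sum, map_smul, Finsupp.coe_finsetSum, Finset.sum_apply, Finsupp.smul_apply, smul_eq_mul]
    simp only [Matrix.mulVec, dotProduct, Pi.smul_apply, smul_eq_mul, Module.Basis.toMatrix_apply] at this
    rw [← this]
    exact Finset.sum_congr rfl fun _ _ => mul_comm _ _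
  have h7 := congrArg l h6
  simp only [map_sum, map_smul, smul_eq_mul] at h7
  simp_rw [h2 (Function.update _ _ _), h4, h2 v]
  calc _ = φ bas * ∑ k, (bas.toMatrix v).cramer (bas.repr w) k * l (v k) := by
        rw [Finset.mul_sum]; exact Finset.sum_congr rfl fun _ _ => by ring
    _ = _ := by rw [h7]; ring

end LinearAlgebra

/-! ### Homotopy invariance of the integral of a holomorphic top form in coordinates. -/

section Homotopy

open Topology Filter

variable {n : ℕ} {E : Type*} [NormedAddCommGroup E] [NormedSpace ℂ E]

/-- Integration by parts against the constant function `1`. -/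
theorem integral_fderiv_eq_zero {X G : Type*} [NormedAddCommGroup X] [NormedSpace ℝ X]
    [MeasurableSpace X] [BorelSpace X] [FiniteDimensional ℝ X] {μ : Measure X}
    [μ.IsAddHaarMeasure] [NormedAddCommGroup G] [NormedSpace ℝ G]
    {f : X → G} (hf : ContDiff ℝ 1 f) (hs : HasCompactSupport f) (v : X) :
    ∫ x, fderiv ℝ f x v ∂μ = 0 := by
  have h1 : Integrable f μ := hf.continuous.integrable_of_hasCompactSupport hs
  have h2 : Integrable (fun x => fderiv ℝ f x v) μ :=
    ((hf.continuous_fderiv one_ne_zero).clm_apply continuous_const).integrable_of_hasCompactSupport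
      ((hs.fderiv ℝ).comp_left (g := fun L : X →L[ℝ] G => L v) (by simp))
  have := integral_smul_fderiv_eq_neg_fderiv_smul_of_integrable (μ := μ) (𝕜 := ℝ)
    (f := fun _ : X => (1 : ℝ)) (g := f) (v := v) (by simp) (by simpa using h2)
    (by simpa using h1) (by simp) (fun x _ => hf.differentiable one_ne_zero x)
  simpa using this

/-- The coordinate vector fields of Euclidean space. -/
abbrev coordVec (k : Fin n) : EuclideanSpace ℝ (Fin n) := EuclideanSpace.single k (1 : ℝ)

/-- The frame `(∂₁ u, …, ∂ₙ u)`. -/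
def frame (u : EuclideanSpace ℝ (Fin n) → E) (x : EuclideanSpace ℝ (Fin n)) : Fin n → E :=
  fun k => fderiv ℝ u x (coordVec k)

/-- The Leibniz rule for a complex multilinear form evaluated on vectors that depend on a real
parameter. -/
theorem hasFDerivAt_alternating {X : Type*} [NormedAddCommGroup X] [NormedSpace ℝ X]
    (A : E [⋀^Fin n]→L[ℂ] ℂ) {g : Fin n → X → E} {g' : Fin n → X →L[ℝ] E} {x : X}
    (hg : ∀ i, HasFDerivAt (g i) (g' i) x) :
    ∃ D : X →L[ℝ] ℂ, HasFDerivAt (fun y => A fun i => g i y) D x ∧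
      ∀ v, D v = ∑ i, A (Function.update (fun j => g j x) i (g' i v)) := by
  refine ⟨_, HasFDerivAt.multilinear_comp
    (A.toContinuousMultilinearMap.restrictScalars ℝ) hg, fun v => ?_⟩
  simp

theorem contDiffAt_alternating {X : Type*} [NormedAddCommGroup X] [NormedSpace ℝ X]
    (A : E [⋀^Fin n]→L[ℂ] ℂ) {g : X → Fin n → E} {x : X} {m : WithTop ℕ∞}
    (hg : ContDiffAt ℝ m g x) : ContDiffAt ℝ m (fun y => A (g y)) x :=
  ((A.toContinuousMultilinearMap.restrictScalars ℝ).contDiff.contDiffAt).comp x hg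

/-- The divergence of the interior product of `F(H) H^* A` with a variation `w` of `H`. -/
theorem sum_fderiv_update [FiniteDimensional ℂ E] (hE : Module.finrank ℂ E = n)
    (A : E [⋀^Fin n]→L[ℂ] ℂ) {F : E → ℂ} {H w : EuclideanSpace ℝ (Fin n) → E}
    {x : EuclideanSpace ℝ (Fin n)} (hF : DifferentiableAt ℂ F (H x)) (hH : ContDiffAt ℝ 2 H x)
    (hw : ContDiffAt ℝ 1 w x) :
    ∑ k, fderiv ℝ (fun y => F (H y) * A (Function.update (frame H y) k (w y))) x (coordVec k) =
      fderiv ℂ F (H x) (w x) * A (frame H x) +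
        F (H x) * ∑ k, A (Function.update (frame H x) k (fderiv ℝ w x (coordVec k))) := by
  have hdH : DifferentiableAt ℝ (fderiv ℝ H) x :=
    (hH.fderiv_right (m := 1) (by norm_num)).differentiableAt one_ne_zero
  have hp : ∀ i, HasFDerivAt (fun y => frame H y i)
      ((ContinuousLinearMap.apply ℝ E (coordVec i)).comp (fderiv ℝ (fderiv ℝ H) x)) x := fun i =>
    (ContinuousLinearMap.apply ℝ E (coordVec i)).hasFDerivAt.comp x hdH.hasFDerivAt
  have hw' : HasFDerivAt w (fderiv ℝ w x) x := (hw.differentiableAt one_ne_zero).hasFDerivAt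
  have hFH : HasFDerivAt (fun y => F (H y))
      (((fderiv ℂ F (H x)).restrictScalars ℝ).comp (fderiv ℝ H x)) x :=
    (hF.hasFDerivAt.restrictScalars ℝ).comp x
      (hH.differentiableAt two_ne_zero).hasFDerivAt
  have hsymm : ∀ i k, fderiv ℝ (fderiv ℝ H) x (coordVec i) (coordVec k) =
      fderiv ℝ (fderiv ℝ H) x (coordVec k) (coordVec i) := fun i k =>
    (hH.isSymmSndFDerivAt (by simp)) _ _
  -- `T k i` collects the second derivatives: `∂ₖ` hits the slot `∂ᵢ H` while `w` sits in slot `k`.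
  -- Symmetry of second derivatives against the alternation of `A` makes `T` antisymmetric, so these
  -- terms cancel in the double sum. The diagonal is zero because slot `k` no longer contains a
  -- derivative of `H`.
  set T : Fin n → Fin n → ℂ := fun k i => if i = k then 0 else
    A (Function.update (Function.update (frame H x) k (w x)) i
      (fderiv ℝ (fderiv ℝ H) x (coordVec k) (coordVec i))) with hT
  have hTanti : ∀ k i, T k i = - T i k := by
    intro k i
    by_cases hki : i = k
    · simp [hT, hki]
    · simp only [hT, hki, Ne.symm hki, if_false]
      have := A.toAlternatingMap.map_swap (Function.update (Function.update (frame H x) k (w x)) i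
        (fderiv ℝ (fderiv ℝ H) x (coordVec k) (coordVec i))) hki
      simp only [ContinuousAlternatingMap.coe_toAlternatingMap] at this
      rw [eq_neg_iff_add_eq_zero, add_comm, ← eq_neg_iff_add_eq_zero, ← this, hsymm]
      congr 1
      funext j
      simp only [Function.comp_apply]
      by_cases hj : j = k
      · subst hj; simp
      · by_cases hj2 : j = i
        · subst hj2; simp [hj, Ne.symm hki]
        · rw [Equiv.swap_apply_of_ne_of_ne hj2 hj]; simp [hj, hj2]
  have hTsum : ∑ k, ∑ i, T k i = 0 := by
    have h1 : ∑ k, ∑ i, T k i = - ∑ k, ∑ i, T k i := by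
      conv_lhs => rw [Finset.sum_comm]
      rw [← Finset.sum_neg_distrib]
      refine Finset.sum_congr rfl fun k _ => ?_
      rw [← Finset.sum_neg_distrib]
      exact Finset.sum_congr rfl fun i _ => hTanti _ _
    exact self_eq_neg.1 h1
  have hterm : ∀ k, fderiv ℝ (fun y => F (H y) * A (Function.update (frame H y) k (w y))) x
      (coordVec k) = fderiv ℂ F (H x) (frame H x k) * A (Function.update (frame H x) k (w x)) +
        F (H x) * A (Function.update (frame H x) k (fderiv ℝ w x (coordVec k))) +
        F (H x) * ∑ i, T k i := by
    intro k
    have hg : ∀ i, HasFDerivAt (fun y => Function.update (frame H y) k (w y) i)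
        (if i = k then fderiv ℝ w x else
          (ContinuousLinearMap.apply ℝ E (coordVec i)).comp (fderiv ℝ (fderiv ℝ H) x)) x := by
      intro i
      by_cases hik : i = k
      · subst hik; simpa using hw'
      · simpa [hik] using hp i
    obtain ⟨D, hD, hDv⟩ := hasFDerivAt_alternating A hg
    have h1 : ∑ i, A (Function.update (fun j => Function.update (frame H x) k (w x) j) i
        ((if i = k then fderiv ℝ w x else
          (ContinuousLinearMap.apply ℝ E (coordVec i)).comp (fderiv ℝ (fderiv ℝ H) x))
          (coordVec k))) =
        A (Function.update (frame H x) k (fderiv ℝ w x (coordVec k))) + ∑ i, T k i := by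
      rw [← Finset.add_sum_erase _ _ (Finset.mem_univ k),
        ← Finset.add_sum_erase _ (T k) (Finset.mem_univ k)]
      have hTk : T k k = 0 := by simp [hT]
      rw [hTk, zero_add]
      congr 1
      · simp
      · refine Finset.sum_congr rfl fun i hi => ?_
        simp [hT, Finset.ne_of_mem_erase hi]
    have h2 := (hFH.mul hD).fderiv
    change fderiv ℝ (fun y => F (H y) * A (Function.update (frame H y) k (w y))) x = _ at h2
    rw [h2]
    simp only [add_apply, smul_apply, smul_eq_mul, hDv, h1,
      ContinuousLinearMap.comp_apply, ContinuousLinearMap.coe_restrictScalars']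
    simp only [frame]
    ring
  simp_rw [hterm, Finset.sum_add_distrib, ← Finset.mul_sum, hTsum, mul_zero, add_zero]
  -- The terms where `F` is differentiated combine by Cramer's rule; this needs `fderiv ℂ F` to be
  -- complex linear, that is, `F` holomorphic.
  rw [sum_apply_mul_update hE]

theorem contDiffAt_frame {H : EuclideanSpace ℝ (Fin n) → E} {x : EuclideanSpace ℝ (Fin n)}
    (hH : ContDiffAt ℝ 2 H x) : ContDiffAt ℝ 1 (frame H) x :=
  contDiffAt_pi.2 fun _ => (hH.fderiv_right (m := 1) (by norm_num)).clm_apply contDiffAt_const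

theorem contDiffAt_update {X : Type*} [NormedAddCommGroup X] [NormedSpace ℝ X]
    {p : X → Fin n → E} {w : X → E} {x : X} {m : WithTop ℕ∞}
    (hp : ContDiffAt ℝ m p x) (hw : ContDiffAt ℝ m w x) (k : Fin n) :
    ContDiffAt ℝ m (fun y => Function.update (p y) k (w y)) x := by
  refine contDiffAt_pi.2 fun i => ?_
  by_cases hik : i = k
  · subst hik; simpa using hw
  · simpa [hik] using contDiffAt_pi.1 hp i

/-- The first variation of the integral vanishes: by `sum_fderiv_update` its integrand is a
divergence, and the underlying vector field is supported in `K` because `w` is. -/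
theorem setIntegral_variation_eq_zero [FiniteDimensional ℂ E] (hE : Module.finrank ℂ E = n)
    (A : E [⋀^Fin n]→L[ℂ] ℂ) {F : E → ℂ} {B : Set E} (hB : IsOpen B) (hF : ContDiffOn ℂ 1 F B)
    {V K : Set (EuclideanSpace ℝ (Fin n))} (hV : IsOpen V) (hK : IsCompact K) (hKV : K ⊆ V)
    {H w : EuclideanSpace ℝ (Fin n) → E} (hH : ContDiffOn ℝ ∞ H V) (hw : ContDiffOn ℝ ∞ w V)
    (hHB : MapsTo H V B) (hwK : ∀ x ∈ V, x ∉ K → w x = 0) :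
    ∫ x in K, (fderiv ℂ F (H x) (w x) * A (frame H x) +
        F (H x) * ∑ k, A (Function.update (frame H x) k (fderiv ℝ w x (coordVec k)))) = 0 := by
  classical
  -- Extension by zero from `V` is `C¹` on the whole space, since the field already vanishes on `V \
  -- K` and `K` is closed.
  set Z : Fin n → EuclideanSpace ℝ (Fin n) → ℂ := fun k =>
    V.indicator (fun y => F (H y) * A (Function.update (frame H y) k (w y))) with hZ
  have hHx : ∀ x ∈ V, ContDiffAt ℝ 2 H x := fun x hx =>
    by exact_mod_cast contDiffAt_infty.1 (hH.contDiffAt (hV.mem_nhds hx)) 2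
  have hwx : ∀ x ∈ V, ContDiffAt ℝ 1 w x := fun x hx =>
    by exact_mod_cast contDiffAt_infty.1 (hw.contDiffAt (hV.mem_nhds hx)) 1
  have hFx : ∀ x ∈ V, ContDiffAt ℂ 1 F (H x) := fun x hx =>
    hF.contDiffAt (hB.mem_nhds (hHB hx))
  have hZV : ∀ k, ∀ x ∈ V, Z k =ᶠ[𝓝 x]
      fun y => F (H y) * A (Function.update (frame H y) k (w y)) := fun k x hx => by
    filter_upwards [hV.mem_nhds hx] with y hy
    simp [hZ, hy]
  have hZ0 : ∀ k, ∀ x, x ∉ K → Z k x = 0 := by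
    intro k x hx
    by_cases hxV : x ∈ V
    · simp only [hZ, hxV, indicator_of_mem, hwK x hxV hx]
      rw [A.map_coord_zero k (by simp), mul_zero]
    · simp [hZ, hxV]
  have hZK : ∀ k, ∀ x, x ∉ K → Z k =ᶠ[𝓝 x] fun _ => 0 := fun k x hx => by
    filter_upwards [hK.isClosed.isOpen_compl.mem_nhds hx] with y hy using hZ0 k y hy
  have hZs : ∀ k, HasCompactSupport (Z k) := fun k => HasCompactSupport.intro hK (hZ0 k)
  have hZc : ∀ k, ContDiff ℝ 1 (Z k) := by
    intro k
    rw [contDiff_iff_contDiffAt]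
    intro x
    by_cases hxV : x ∈ V
    · refine ContDiffAt.congr_of_eventuallyEq ?_ (hZV k x hxV)
      exact (((hFx x hxV).restrict_scalars ℝ).comp x ((hHx x hxV).of_le (by norm_num))).mul
        (contDiffAt_alternating A (contDiffAt_update (contDiffAt_frame (hHx x hxV))
          (hwx x hxV) k))
    · exact contDiffAt_const.congr_of_eventuallyEq (hZK k x fun h => hxV (hKV h))
  have h1 : ∫ x, ∑ k, fderiv ℝ (Z k) x (coordVec k) = 0 := by
    rw [integral_finsetSum]
    · exact Finset.sum_eq_zero fun k _ => integral_fderiv_eq_zero (hZc k) (hZs k) _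
    · intro k _
      exact (((hZc k).continuous_fderiv one_ne_zero).clm_apply
        continuous_const).integrable_of_hasCompactSupport
        (((hZs k).fderiv ℝ).comp_left
          (g := fun L : EuclideanSpace ℝ (Fin n) →L[ℝ] ℂ => L (coordVec k)) (by simp))
  rw [← setIntegral_eq_integral_of_forall_compl_eq_zero (s := K)] at h1
  · rw [← h1]
    refine setIntegral_congr_fun hK.measurableSet fun x hx => ?_
    have hxV := hKV hx
    rw [← sum_fderiv_update hE A ((hFx x hxV).differentiableAt one_ne_zero) (hHx x hxV)
      (hwx x hxV)]
    exact Finset.sum_congr rfl fun k _ => by rw [(hZV k x hxV).fderiv_eq]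
  · intro x hx
    exact Finset.sum_eq_zero fun k _ => by rw [(hZK k x hx).fderiv_eq]; simp

/-- The integral of a holomorphic volume form over a compact piece of a map does not change
when the map is deformed inside a convex set, relative to the boundary. -/
theorem setIntegral_pullback_sub_eq_zero [FiniteDimensional ℂ E] (hE : Module.finrank ℂ E = n)
    (A : E [⋀^Fin n]→L[ℂ] ℂ) {F : E → ℂ} {B : Set E} (hB : IsOpen B) (hBc : Convex ℝ B)
    (hF : ContDiffOn ℂ 1 F B)
    {V K : Set (EuclideanSpace ℝ (Fin n))} (hV : IsOpen V) (hK : IsCompact K) (hKV : K ⊆ V)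
    {u v : EuclideanSpace ℝ (Fin n) → E} (hu : ContDiffOn ℝ ∞ u V) (hv : ContDiffOn ℝ ∞ v V)
    (huB : MapsTo u V B) (hvB : MapsTo v V B) (huv : ∀ x ∈ V, x ∉ K → v x = u x) :
    ∫ x in K, (F (v x) * A (frame v x) - F (u x) * A (frame u x)) = 0 := by
  set w := fun x => v x - u x with hw_def
  have hw : ContDiffOn ℝ ∞ w V := hv.sub hu
  set p : ℝ → EuclideanSpace ℝ (Fin n) → Fin n → E :=
    fun t x k => frame u x k + t • fderiv ℝ w x (coordVec k) with hp
  set h : ℝ → EuclideanSpace ℝ (Fin n) → E := fun t x => u x + t • w x with hh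
  -- `Q` is the `t`-derivative of the integrand along the linear homotopy `h t` from `u` to `v`,
  -- which stays in `B` by convexity. The result follows by integrating it over `t` and exchanging
  -- the integrals over `t` and `x`.
  set Q : ℝ → EuclideanSpace ℝ (Fin n) → ℂ := fun t x =>
    fderiv ℂ F (h t x) (w x) * A (p t x) +
      F (h t x) * ∑ k, A (Function.update (p t x) k (fderiv ℝ w x (coordVec k))) with hQ
  have hud : ∀ x ∈ V, DifferentiableAt ℝ u x := fun x hx =>
    (hu.contDiffAt (hV.mem_nhds hx)).differentiableAt (by simp)
  have hvd : ∀ x ∈ V, DifferentiableAt ℝ v x := fun x hx =>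
    (hv.contDiffAt (hV.mem_nhds hx)).differentiableAt (by simp)
  have hwd : ∀ x ∈ V, DifferentiableAt ℝ w x := fun x hx => (hvd x hx).sub (hud x hx)
  have hframe : ∀ t, ∀ x ∈ V, frame (h t) x = p t x := by
    intro t x hx
    funext k
    have : HasFDerivAt (h t) (fderiv ℝ u x + t • fderiv ℝ w x) x :=
      (hud x hx).hasFDerivAt.add ((hwd x hx).hasFDerivAt.const_smul t)
    simp only [frame, this.fderiv, hp]
    simp
  have hhB : ∀ t ∈ Icc (0 : ℝ) 1, MapsTo (h t) V B := by
    intro t ht x hx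
    have := hBc (huB hx) (hvB hx) (sub_nonneg.2 ht.2) ht.1 (by ring)
    have h2 : h t x = (1 - t) • u x + t • v x := by
      simp only [hh, hw_def, smul_sub, sub_smul, one_smul]; abel
    rwa [h2]
  have hh0 : ∀ x, h 0 x = u x := fun x => by simp [hh]
  have hh1 : h 1 = v := by funext x; simp [hh, hw_def]
  have hh0' : h 0 = u := funext hh0
  have hzero : ∀ t ∈ Icc (0 : ℝ) 1, ∫ x in K, Q t x = 0 := by
    intro t ht
    rw [← setIntegral_variation_eq_zero hE A hB hF hV hK hKV
      (H := h t) (hu.add (hw.const_smul t)) hw (hhB t ht)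
      (fun x hx hxK => by simp [hw_def, huv x hx hxK])]
    refine setIntegral_congr_fun hK.measurableSet fun x hx => ?_
    simp only [hQ, hframe t x (hKV hx)]
  have hwc : ContinuousOn w V := hw.continuousOn
  have hfw : ContinuousOn (fderiv ℝ w) V := hw.continuousOn_fderiv_of_isOpen hV (by simp)
  have hfu : ContinuousOn (fderiv ℝ u) V := hu.continuousOn_fderiv_of_isOpen hV (by simp)
  have hsnd : MapsTo (Prod.snd : ℝ × EuclideanSpace ℝ (Fin n) → _) (Icc (0 : ℝ) 1 ×ˢ V) V :=
    fun z hz => hz.2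
  have hhc : ContinuousOn (fun z : ℝ × EuclideanSpace ℝ (Fin n) => h z.1 z.2)
      (Icc (0 : ℝ) 1 ×ˢ V) :=
    (hu.continuousOn.comp continuousOn_snd hsnd).add
      (continuousOn_fst.smul (hwc.comp continuousOn_snd hsnd))
  have hpc : ContinuousOn (fun z : ℝ × EuclideanSpace ℝ (Fin n) => p z.1 z.2)
      (Icc (0 : ℝ) 1 ×ˢ V) := by
    refine continuousOn_pi.2 fun k => ?_
    exact ((hfu.comp continuousOn_snd hsnd).clm_apply continuousOn_const).add
      (continuousOn_fst.smul ((hfw.comp continuousOn_snd hsnd).clm_apply continuousOn_const))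
  have hhmaps : MapsTo (fun z : ℝ × EuclideanSpace ℝ (Fin n) => h z.1 z.2)
      (Icc (0 : ℝ) 1 ×ˢ V) B := fun z hz => hhB z.1 hz.1 hz.2
  have hAc : Continuous (fun y : Fin n → E => A y) := A.cont
  have hQc : ContinuousOn (Function.uncurry Q) (Icc (0 : ℝ) 1 ×ˢ V) := by
    refine ContinuousOn.add (ContinuousOn.mul ?_ ?_) (ContinuousOn.mul ?_ ?_)
    · exact ((hF.continuousOn_fderiv_of_isOpen hB le_rfl).comp hhc hhmaps).clm_apply
        (hwc.comp continuousOn_snd hsnd)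
    · exact hAc.comp_continuousOn hpc
    · exact hF.continuousOn.comp hhc hhmaps
    · refine continuousOn_finsetSum _ fun k _ => hAc.comp_continuousOn ?_
      refine continuousOn_pi.2 fun i => ?_
      by_cases hik : i = k
      · subst hik
        simpa using (hfw.comp continuousOn_snd hsnd).clm_apply continuousOn_const
      · simpa [hik] using continuousOn_pi.1 hpc i
  have hQi : Integrable (Function.uncurry Q)
      ((volume.restrict (Ioc (0 : ℝ) 1)).prod (volume.restrict K)) := by
    rw [Measure.prod_restrict]
    refine IntegrableOn.mono_set ?_ (prod_mono_left Ioc_subset_Icc_self)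
    exact (hQc.mono (prod_mono_right hKV)).integrableOn_compact (isCompact_Icc.prod hK)
  have hftc : ∀ x ∈ K, F (v x) * A (frame v x) - F (u x) * A (frame u x) =
      ∫ t in Ioc (0 : ℝ) 1, Q t x := by
    intro x hx
    have hxV := hKV hx
    have hder : ∀ t ∈ uIcc (0 : ℝ) 1, HasDerivAt (fun s => F (h s x) * A (p s x)) (Q t x) t := by
      intro t ht
      rw [uIcc_of_le zero_le_one] at ht
      have h1 : HasDerivAt (fun s => h s x) (w x) t := by
        have := ((hasDerivAt_id t).smul_const (w x)).const_add (u x)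
        rwa [one_smul] at this
      have h2 : HasDerivAt (fun s => F (h s x)) (fderiv ℂ F (h t x) (w x)) t := by
        have h0 := ((hF.contDiffAt (hB.mem_nhds (hhB t ht hxV))).differentiableAt
            one_ne_zero).hasFDerivAt.restrictScalars ℝ
        exact h0.comp_hasDerivAt t h1
      have h3 : ∀ k, HasFDerivAt (fun s => p s x k)
          (ContinuousLinearMap.toSpanSingleton ℝ (fderiv ℝ w x (coordVec k))) t := by
        intro k
        have := ((hasDerivAt_id t).smul_const (fderiv ℝ w x (coordVec k))).const_add
          (frame u x k)
        rw [one_smul] at this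
        exact this.hasFDerivAt
      obtain ⟨D, hD, hDv⟩ := hasFDerivAt_alternating A h3
      have h4 : HasDerivAt (fun s => A (p s x))
          (∑ k, A (Function.update (p t x) k (fderiv ℝ w x (coordVec k)))) t := by
        have := hD.hasDerivAt
        rw [hDv] at this
        simpa using this
      exact h2.mul h4
    have hint : IntervalIntegrable (fun t => Q t x) volume 0 1 := by
      refine ContinuousOn.intervalIntegrable ?_
      rw [uIcc_of_le zero_le_one]
      exact hQc.comp (f := fun t : ℝ => (t, x)) (by fun_prop) fun t ht => ⟨ht, hxV⟩
    have := intervalIntegral.integral_eq_sub_of_hasDerivAt hder hint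
    rw [intervalIntegral.integral_of_le zero_le_one] at this
    rw [this, ← hframe 1 x hxV, ← hframe 0 x hxV, hh1, hh0']
  rw [setIntegral_congr_fun hK.measurableSet hftc]
  rw [← integral_integral_swap hQi]
  rw [setIntegral_congr_fun measurableSet_Ioc (g := fun _ => (0 : ℂ))
    fun t ht => hzero t (Ioc_subset_Icc_self ht)]
  simp

end Homotopy

set_option linter.unusedSectionVars false

/-! ### The Riemannian volume in arbitrary smooth charts. -/

section RiemannianVolume

open Topology Filter
open scoped ENNReal

variable {n : ℕ} {L : Type*} [TopologicalSpace L] [ChartedSpace (EuclideanSpace ℝ (Fin n)) L]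

/-- A chart which is a diffeomorphism onto an open subset of Euclidean space. -/
structure IsSmoothChart (e : OpenPartialHomeomorph L (EuclideanSpace ℝ (Fin n))) : Prop where
  contMDiffOn : ContMDiffOn (𝓡 n) (𝓡 n) ∞ e e.source
  contMDiffOn_symm : ContMDiffOn (𝓡 n) (𝓡 n) ∞ e.symm e.target

theorem isSmoothChart_of_mem_atlas [IsManifold (𝓡 n) ∞ L]
    {e : OpenPartialHomeomorph L (EuclideanSpace ℝ (Fin n))}
    (he : e ∈ atlas (EuclideanSpace ℝ (Fin n)) L) : IsSmoothChart e :=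
  ⟨contMDiffOn_of_mem_maximalAtlas (IsManifold.subset_maximalAtlas he),
    contMDiffOn_symm_of_mem_maximalAtlas (IsManifold.subset_maximalAtlas he)⟩

theorem IsSmoothChart.mdifferentiableAt
    {e : OpenPartialHomeomorph L (EuclideanSpace ℝ (Fin n))} (he : IsSmoothChart e) {q : L}
    (hq : q ∈ e.source) : MDifferentiableAt (𝓡 n) (𝓡 n) e q :=
  (he.contMDiffOn.contMDiffAt (e.open_source.mem_nhds hq)).mdifferentiableAt (by simp)

theorem IsSmoothChart.mdifferentiableAt_symm
    {e : OpenPartialHomeomorph L (EuclideanSpace ℝ (Fin n))} (he : IsSmoothChart e)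
    {x : EuclideanSpace ℝ (Fin n)}
    (hx : x ∈ e.target) : MDifferentiableAt (𝓡 n) (𝓡 n) e.symm x :=
  (he.contMDiffOn_symm.contMDiffAt (e.open_target.mem_nhds hx)).mdifferentiableAt (by simp)

theorem IsSmoothChart.differentiableAt_transition
    {e e' : OpenPartialHomeomorph L (EuclideanSpace ℝ (Fin n))} (he : IsSmoothChart e)
    (he' : IsSmoothChart e') {x : EuclideanSpace ℝ (Fin n)} (hx : x ∈ e.target)
    (hx' : e.symm x ∈ e'.source) : DifferentiableAt ℝ (e' ∘ e.symm) x :=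
  mdifferentiableAt_iff_differentiableAt.1
    ((he'.mdifferentiableAt hx').comp x (he.mdifferentiableAt_symm hx))

theorem IsSmoothChart.mfderiv_symm_eq
    {e e' : OpenPartialHomeomorph L (EuclideanSpace ℝ (Fin n))} (he : IsSmoothChart e)
    (he' : IsSmoothChart e') {x : EuclideanSpace ℝ (Fin n)} (hx : x ∈ e.target)
    (hx' : e.symm x ∈ e'.source) (v : EuclideanSpace ℝ (Fin n)) :
    (mfderiv (𝓡 n) (𝓡 n) e.symm x v : EuclideanSpace ℝ (Fin n)) =
      mfderiv (𝓡 n) (𝓡 n) e'.symm (e' (e.symm x)) (fderiv ℝ (e' ∘ e.symm) x v) := by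
  have h1 : e.symm =ᶠ[𝓝 x] e'.symm ∘ (e' ∘ e.symm) := by
    have := (e.continuousAt_symm hx).preimage_mem_nhds (e'.open_source.mem_nhds hx')
    filter_upwards [this] with y hy
    simp [e'.left_inv hy]
  have h2 : MDifferentiableAt (𝓡 n) (𝓡 n) (e' ∘ e.symm) x :=
    (he'.mdifferentiableAt hx').comp x (he.mdifferentiableAt_symm hx)
  rw [h1.mfderiv_eq, mfderiv_comp x (he'.mdifferentiableAt_symm (e'.map_source hx')) h2,
    mfderiv_eq_fderiv]
  rfl

/-- A family of bilinear forms on the tangent spaces. -/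
def IsBilinear (G : ∀ q : L, TangentSpace (𝓡 n) q → TangentSpace (𝓡 n) q → ℝ) : Prop :=
  ∀ q, ∃ B : LinearMap.BilinForm ℝ (EuclideanSpace ℝ (Fin n)), ∀ u v, G q u v = B u v

/-- The Gram matrices in the two charts are congruent through the Jacobian matrix `P`, so their
determinants differ by `P.det ^ 2`. -/
theorem chartDensity_transition
    {G : ∀ q : L, TangentSpace (𝓡 n) q → TangentSpace (𝓡 n) q → ℝ} (hG : IsBilinear G)
    {e e' : OpenPartialHomeomorph L (EuclideanSpace ℝ (Fin n))} (he : IsSmoothChart e)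
    (he' : IsSmoothChart e') {x : EuclideanSpace ℝ (Fin n)} (hx : x ∈ e.target)
    (hx' : e.symm x ∈ e'.source) :
    chartDensity G e x =
      |(fderiv ℝ (e' ∘ e.symm) x).det| * chartDensity G e' (e' (e.symm x)) := by
  obtain ⟨B, hB⟩ := hG (e.symm x)
  set P : Matrix (Fin n) (Fin n) ℝ :=
    Matrix.of fun i j => (fderiv ℝ (e' ∘ e.symm) x (EuclideanSpace.single j 1)) i with hP
  set N : EuclideanSpace ℝ (Fin n) →L[ℝ] EuclideanSpace ℝ (Fin n) :=
    mfderiv (𝓡 n) (𝓡 n) e'.symm (e' (e.symm x)) with hN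
  have hdet : (fderiv ℝ (e' ∘ e.symm) x).det = P.det := by
    rw [ContinuousLinearMap.det, ← LinearMap.det_toMatrix (EuclideanSpace.basisFun (Fin n) ℝ).toBasis]
    congr 1
  have hcol : ∀ j, fderiv ℝ (e' ∘ e.symm) x (EuclideanSpace.single j 1) =
      ∑ i, P i j • EuclideanSpace.single i (1 : ℝ) := by
    intro j
    ext i
    simp [hP, Finset.sum_apply, Pi.single_apply]
  have hmat : (Matrix.of fun j k : Fin n => G (e.symm x)
      (mfderiv (𝓡 n) (𝓡 n) e.symm x (EuclideanSpace.single j (1 : ℝ)))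
      (mfderiv (𝓡 n) (𝓡 n) e.symm x (EuclideanSpace.single k (1 : ℝ)))) =
      P.transpose * (Matrix.of fun j k : Fin n => B
      (N (EuclideanSpace.single j (1 : ℝ))) (N (EuclideanSpace.single k (1 : ℝ)))) * P := by
    ext j k
    rw [Matrix.of_apply, hB, he.mfderiv_symm_eq he' hx hx', he.mfderiv_symm_eq he' hx hx',
      hcol, hcol]
    change B (N _) (N _) = _
    simp only [map_sum, map_smul, LinearMap.sum_apply, LinearMap.smul_apply, smul_eq_mul,
      Matrix.mul_apply, Matrix.transpose_apply, Matrix.of_apply, Finset.sum_mul, Finset.mul_sum]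
    refine Finset.sum_congr rfl fun i _ => Finset.sum_congr rfl fun l _ => ?_
    ring
  have hq : e'.symm (e' (e.symm x)) = e.symm x := e'.left_inv hx'
  have hB' : ∀ u v : EuclideanSpace ℝ (Fin n), G (e'.symm (e' (e.symm x))) u v = B u v := by
    rw [hq]; exact hB
  unfold chartDensity
  rw [hmat, Matrix.det_mul, Matrix.det_mul, Matrix.det_transpose, hdet]
  rw [show P.det * (Matrix.of fun j k : Fin n => B
      (N (EuclideanSpace.single j (1 : ℝ))) (N (EuclideanSpace.single k (1 : ℝ)))).det * P.det =
      P.det ^ 2 * (Matrix.of fun j k : Fin n => B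
      (N (EuclideanSpace.single j (1 : ℝ))) (N (EuclideanSpace.single k (1 : ℝ)))).det by ring,
    Real.sqrt_mul (sq_nonneg _), Real.sqrt_sq_eq_abs]
  congr 3
  ext j k
  exact (hB' _ _).symm

theorem chartDensity_nonneg (G : ∀ q : L, TangentSpace (𝓡 n) q → TangentSpace (𝓡 n) q → ℝ)
    (e : OpenPartialHomeomorph L (EuclideanSpace ℝ (Fin n))) (x : EuclideanSpace ℝ (Fin n)) :
    0 ≤ chartDensity G e x := Real.sqrt_nonneg _

theorem aemeasurable_symm {L : Type*} [TopologicalSpace L] [MeasurableSpace L] [BorelSpace L]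
    (e : OpenPartialHomeomorph L (EuclideanSpace ℝ (Fin n))) :
    AEMeasurable e.symm (volume.restrict e.target) :=
  e.continuousOn_symm.aemeasurable e.open_target.measurableSet

theorem setLIntegral_eq_of_subset {X : Type*} [MeasurableSpace X] {μ : Measure X} {S T : Set X}
    (hS : MeasurableSet S) (hT : MeasurableSet T) (hTS : T ⊆ S) {f : X → ℝ≥0∞}
    (hf : ∀ x ∈ S, x ∉ T → f x = 0) : ∫⁻ x in S, f x ∂μ = ∫⁻ x in T, f x ∂μ := by
  rw [← lintegral_indicator hS, ← lintegral_indicator hT]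
  refine lintegral_congr fun x => ?_
  by_cases hxS : x ∈ S
  · by_cases hxT : x ∈ T
    · simp [hxS, hxT]
    · simp [hxS, hxT, hf x hxS hxT]
  · have hxT : x ∉ T := fun h => hxS (hTS h)
    simp [hxS, hxT]

variable [T2Space L] [CompactSpace L] [IsManifold (𝓡 n) ∞ L] [MeasurableSpace L] [BorelSpace L]

theorem chartPartition_eq_zero {p q : L}
    (hq : q ∉ (chartAt (EuclideanSpace ℝ (Fin n)) p).source) : chartPartition n L p q = 0 := by
  have h := Classical.choose_spec
    (SmoothPartitionOfUnity.exists_isSubordinate_chartAt_source (𝓡 n) L) p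
  by_contra h0
  exact hq (h (subset_tsupport _ h0))

theorem exists_finset_chartPartition :
    ∃ s : Finset L, (∀ p ∉ s, ∀ q, chartPartition n L p q = 0) ∧
      ∀ q, ∑ p ∈ s, ENNReal.ofReal (chartPartition n L p q) = 1 := by
  have hfin := (chartPartition n L).locallyFinite.finite_nonempty_of_compact
  have h1 : ∀ p ∉ hfin.toFinset, ∀ q, chartPartition n L p q = 0 := by
    intro p hp q
    by_contra h0
    refine hp ((Finite.mem_toFinset _).2 ⟨q, h0⟩)
  refine ⟨hfin.toFinset, h1, fun q => ?_⟩
  rw [← ENNReal.ofReal_sum_of_nonneg fun p _ => (chartPartition n L).nonneg p q]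
  have h2 := (chartPartition n L).sum_eq_one (mem_univ q)
  rw [finsum_eq_sum_of_support_subset (s := hfin.toFinset)] at h2
  · rw [h2, ENNReal.ofReal_one]
  · intro p hp
    by_contra h3
    exact hp (h1 p h3 q)

/-- A family of bilinear forms with continuous densities in all charts. -/
structure HasContinuousDensity
    (G : ∀ q : L, TangentSpace (𝓡 n) q → TangentSpace (𝓡 n) q → ℝ) : Prop where
  bilin : IsBilinear G
  continuousOn : ∀ e : OpenPartialHomeomorph L (EuclideanSpace ℝ (Fin n)), IsSmoothChart e →
    ContinuousOn (chartDensity G e) e.target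

theorem aemeasurable_weight (G : ∀ q : L, TangentSpace (𝓡 n) q → TangentSpace (𝓡 n) q → ℝ)
    (hG : HasContinuousDensity G) (p : L) : AEMeasurable (fun x =>
        ENNReal.ofReal (chartPartition n L p ((chartAt (EuclideanSpace ℝ (Fin n)) p).symm x)
          * chartDensity G (chartAt (EuclideanSpace ℝ (Fin n)) p) x))
      (volume.restrict (chartAt (EuclideanSpace ℝ (Fin n)) p).target) := by
  refine AEMeasurable.ennreal_ofReal (ContinuousOn.aemeasurable ?_
    (chartAt (EuclideanSpace ℝ (Fin n)) p).open_target.measurableSet)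
  exact ((chartPartition n L p).2.continuous.comp_continuousOn
    (chartAt (EuclideanSpace ℝ (Fin n)) p).continuousOn_symm).mul
    (hG.continuousOn _ (isSmoothChart_of_mem_atlas (chart_mem_atlas _ p)))

/-- Change of variables on the overlap of the two charts; outside it `g` vanishes. -/
theorem lintegral_chart_change
    {G : ∀ q : L, TangentSpace (𝓡 n) q → TangentSpace (𝓡 n) q → ℝ} (hG : IsBilinear G)
    {e e' : OpenPartialHomeomorph L (EuclideanSpace ℝ (Fin n))} (he : IsSmoothChart e)
    (he' : IsSmoothChart e') (g : L → ℝ≥0∞) (hge : ∀ q ∉ e.source, g q = 0)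
    (hge' : ∀ q ∉ e'.source, g q = 0) :
    ∫⁻ x in e'.target, ENNReal.ofReal (chartDensity G e' x) * g (e'.symm x) =
      ∫⁻ x in e.target, ENNReal.ofReal (chartDensity G e x) * g (e.symm x) := by
  set T : Set (EuclideanSpace ℝ (Fin n)) := (e.symm.trans e').source with hT
  have hTm : MeasurableSet T := (e.symm.trans e').open_source.measurableSet
  have hTmem : ∀ x, x ∈ T ↔ x ∈ e.target ∧ e.symm x ∈ e'.source := fun x => by
    simp [hT]
  have himg : (e' ∘ e.symm) '' T = e'.target ∩ e'.symm ⁻¹' e.source := by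
    have h1 := (e.symm.trans e').image_source_eq_target
    simpa [hT, OpenPartialHomeomorph.trans_target] using h1
  have hinj : InjOn (e' ∘ e.symm) T := (e.symm.trans e').injOn
  have hder : ∀ x ∈ T, HasFDerivWithinAt (e' ∘ e.symm) (fderiv ℝ (e' ∘ e.symm) x) T x :=
    fun x hx => (he.differentiableAt_transition he' ((hTmem x).1 hx).1
      ((hTmem x).1 hx).2).hasFDerivAt.hasFDerivWithinAt
  have hcov := lintegral_image_eq_lintegral_abs_det_fderiv_mul volume hTm hder hinj
    (fun x => ENNReal.ofReal (chartDensity G e' x) * g (e'.symm x))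
  have hleft : ∫⁻ x in e'.target, ENNReal.ofReal (chartDensity G e' x) * g (e'.symm x) =
      ∫⁻ x in (e' ∘ e.symm) '' T, ENNReal.ofReal (chartDensity G e' x) * g (e'.symm x) := by
    rw [himg]
    refine setLIntegral_eq_of_subset e'.open_target.measurableSet
      (e'.symm.isOpen_inter_preimage e.open_source).measurableSet
      inter_subset_left fun x hx hx' => ?_
    rw [hge _ fun h => hx' ⟨hx, h⟩, mul_zero]
  have hright : ∫⁻ x in e.target, ENNReal.ofReal (chartDensity G e x) * g (e.symm x) =
      ∫⁻ x in T, ENNReal.ofReal (chartDensity G e x) * g (e.symm x) := by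
    refine setLIntegral_eq_of_subset e.open_target.measurableSet hTm
      (fun x hx => ((hTmem x).1 hx).1) fun x hx hx' => ?_
    rw [hge' _ fun h => hx' ((hTmem x).2 ⟨hx, h⟩), mul_zero]
  rw [hleft, hright, hcov]
  refine setLIntegral_congr_fun hTm fun x hx => ?_
  have hx' := (hTmem x).1 hx
  simp only [Function.comp_apply]
  rw [e'.left_inv hx'.2, chartDensity_transition hG he he' hx'.1 hx'.2,
    ENNReal.ofReal_mul (abs_nonneg _), mul_assoc]

/-- The Riemannian volume in an arbitrary chart. -/
theorem setLIntegral_riemannianVolume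
    {G : ∀ q : L, TangentSpace (𝓡 n) q → TangentSpace (𝓡 n) q → ℝ} (hG : HasContinuousDensity G)
    {e : OpenPartialHomeomorph L (EuclideanSpace ℝ (Fin n))} (he : IsSmoothChart e)
    {g : L → ℝ≥0∞} (hg : Measurable g) (hge : ∀ q ∉ e.source, g q = 0) :
    ∫⁻ q, g q ∂(riemannianVolume G) =
      ∫⁻ x in e.target, ENNReal.ofReal (chartDensity G e x) * g (e.symm x) := by
  obtain ⟨s, hs0, hs1⟩ := exists_finset_chartPartition (n := n) (L := L)
  rw [riemannianVolume, lintegral_sum_measure]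
  have hterm : ∀ p : L, ∫⁻ q, g q ∂((((volume : Measure (EuclideanSpace ℝ (Fin n))).restrict
      (chartAt (EuclideanSpace ℝ (Fin n)) p).target).withDensity fun x =>
        ENNReal.ofReal (chartPartition n L p ((chartAt (EuclideanSpace ℝ (Fin n)) p).symm x)
          * chartDensity G (chartAt (EuclideanSpace ℝ (Fin n)) p) x)).map
      (chartAt (EuclideanSpace ℝ (Fin n)) p).symm) =
      ∫⁻ x in e.target, ENNReal.ofReal (chartDensity G e x) *
        (ENNReal.ofReal (chartPartition n L p (e.symm x)) * g (e.symm x)) := by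
    intro p
    have hp := isSmoothChart_of_mem_atlas (chart_mem_atlas (EuclideanSpace ℝ (Fin n)) p)
    -- The piece of the measure belonging to `p` is moved from the chart at `p` to `e`, where all
    -- pieces can be added and the partition functions sum to `1`.
    rw [← lintegral_chart_change hG.bilin he hp
      (fun q => ENNReal.ofReal (chartPartition n L p q) * g q)
      (fun q hq => by simp [hge q hq]) (fun q hq => by simp [chartPartition_eq_zero hq])]
    have hsm := aemeasurable_symm (chartAt (EuclideanSpace ℝ (Fin n)) p)
    rw [lintegral_map' hg.aemeasurable (hsm.mono_ac (withDensity_absolutelyContinuous _ _)),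
      lintegral_withDensity_eq_lintegral_mul₀ (aemeasurable_weight G hG p)
        (show AEMeasurable (fun x => g (_ : L)) _ from hg.comp_aemeasurable hsm)]
    refine lintegral_congr fun x => ?_
    simp only [Pi.mul_apply]
    rw [ENNReal.ofReal_mul ((chartPartition n L).nonneg p _)]
    ring
  simp_rw [hterm]
  rw [tsum_eq_sum (s := s) fun p hp => by simp [hs0 p hp]]
  have hDm : AEMeasurable (fun x => ENNReal.ofReal (chartDensity G e x))
      (volume.restrict e.target) :=
    ((hG.continuousOn e he).aemeasurable e.open_target.measurableSet).ennreal_ofReal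
  rw [← lintegral_finsetSum']
  · refine lintegral_congr fun x => ?_
    rw [← Finset.mul_sum, ← Finset.sum_mul, hs1, one_mul]
  · intro p _
    refine hDm.mul ((AEMeasurable.ennreal_ofReal ?_).mul
      (hg.comp_aemeasurable (aemeasurable_symm e)))
    exact (chartPartition n L p).2.continuous.measurable.comp_aemeasurable (aemeasurable_symm e)

/-- Shows that the partition of unity in the definition is immaterial: over the domain of any smooth
chart the measure is given by the density of that chart alone. -/
theorem restrict_riemannianVolume
    {G : ∀ q : L, TangentSpace (𝓡 n) q → TangentSpace (𝓡 n) q → ℝ} (hG : HasContinuousDensity G)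
    {e : OpenPartialHomeomorph L (EuclideanSpace ℝ (Fin n))} (he : IsSmoothChart e) :
    (riemannianVolume G).restrict e.source =
      ((volume.restrict e.target).withDensity
        fun x => ENNReal.ofReal (chartDensity G e x)).map e.symm := by
  have hDm : AEMeasurable (fun x => ENNReal.ofReal (chartDensity G e x))
      (volume.restrict e.target) :=
    ((hG.continuousOn e he).aemeasurable e.open_target.measurableSet).ennreal_ofReal
  have hsm := aemeasurable_symm e
  ext A hA
  have hAe : MeasurableSet (A ∩ e.source) := hA.inter e.open_source.measurableSet
  rw [Measure.restrict_apply hA, ← lintegral_indicator_one hAe,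
    setLIntegral_riemannianVolume hG he (measurable_one.indicator hAe)
      (fun q hq => by simp [hq]),
    ← lintegral_indicator_one hA,
    lintegral_map' (measurable_one.indicator hA).aemeasurable
      (hsm.mono_ac (withDensity_absolutelyContinuous _ _)),
      lintegral_withDensity_eq_lintegral_mul₀ hDm
        (show AEMeasurable (fun x => A.indicator 1 (e.symm x)) _ from
          (measurable_one.indicator hA).comp_aemeasurable hsm)]
  refine setLIntegral_congr_fun e.open_target.measurableSet fun x hx => ?_
  simp only [Pi.mul_apply]
  congr 1
  by_cases hxA : e.symm x ∈ A
  · simp [hxA, e.map_target hx]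
  · simp [hxA]

theorem measure_ext_of_charts {μ ν : Measure L}
    (h : ∀ p : L, μ.restrict (chartAt (EuclideanSpace ℝ (Fin n)) p).source =
      ν.restrict (chartAt (EuclideanSpace ℝ (Fin n)) p).source) : μ = ν := by
  obtain ⟨s, hs⟩ := isCompact_univ.elim_finite_subcover
    (fun p : L => (chartAt (EuclideanSpace ℝ (Fin n)) p).source)
    (fun p => (chartAt (EuclideanSpace ℝ (Fin n)) p).open_source)
    (fun p _ => mem_iUnion.2 ⟨p, mem_chart_source _ p⟩)
  refine Measure.ext_of_biUnion_eq_univ (S := (s : Set L)) s.countable_toSet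
    (s := fun p : L => (chartAt (EuclideanSpace ℝ (Fin n)) p).source) ?_ fun p _ => h p
  exact univ_subset_iff.1 hs

theorem setIntegral_riemannianVolume {F : Type*} [NormedAddCommGroup F] [NormedSpace ℝ F]
    {G : ∀ q : L, TangentSpace (𝓡 n) q → TangentSpace (𝓡 n) q → ℝ} (hG : HasContinuousDensity G)
    {e : OpenPartialHomeomorph L (EuclideanSpace ℝ (Fin n))} (he : IsSmoothChart e)
    {g : L → F} (hg : AEStronglyMeasurable g ((riemannianVolume G).restrict e.source)) :
    ∫ q in e.source, g q ∂(riemannianVolume G) =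
      ∫ x in e.target, chartDensity G e x • g (e.symm x) := by
  have hDm : AEMeasurable (fun x => ENNReal.ofReal (chartDensity G e x))
      (volume.restrict e.target) :=
    ((hG.continuousOn e he).aemeasurable e.open_target.measurableSet).ennreal_ofReal
  have hsm := aemeasurable_symm e
  rw [restrict_riemannianVolume hG he] at hg ⊢
  rw [integral_map (hsm.mono_ac (withDensity_absolutelyContinuous _ _)) hg,
    integral_withDensity_eq_integral_toReal_smul₀ hDm (by simp)]
  refine integral_congr_ae (Eventually.of_forall fun x => ?_)
  simp only
  rw [ENNReal.toReal_ofReal (chartDensity_nonneg G e x)]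

theorem isFiniteMeasure_riemannianVolume
    {G : ∀ q : L, TangentSpace (𝓡 n) q → TangentSpace (𝓡 n) q → ℝ}
    (hG : HasContinuousDensity G) : IsFiniteMeasure (riemannianVolume G) := by
  -- A continuous density has finite integral over a compact subset of a chart target; compactness
  -- of `L` then upgrades local finiteness to finiteness.
  have : IsLocallyFiniteMeasure (riemannianVolume G) := by
    refine ⟨fun q => ?_⟩
    set e := chartAt (EuclideanSpace ℝ (Fin n)) q with he_def
    have he : IsSmoothChart e := isSmoothChart_of_mem_atlas (chart_mem_atlas _ q)
    have hq : q ∈ e.source := mem_chart_source _ q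
    obtain ⟨K, hKc, hKn, hKsub⟩ : ∃ K : Set (EuclideanSpace ℝ (Fin n)), IsCompact K ∧
        K ∈ 𝓝 (e q) ∧ K ⊆ e.target := by
      obtain ⟨K, hK, hK2, hK3⟩ := local_compact_nhds (e.open_target.mem_nhds (e.map_source hq))
      exact ⟨K, hK3, hK, hK2⟩
    set W := e.source ∩ e ⁻¹' (interior K) with hW
    have hWo : IsOpen W := e.isOpen_inter_preimage isOpen_interior
    refine ⟨W, hWo.mem_nhds ⟨hq, mem_interior_iff_mem_nhds.2 hKn⟩, ?_⟩
    rw [← lintegral_indicator_one hWo.measurableSet,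
      setLIntegral_riemannianVolume hG he (measurable_one.indicator hWo.measurableSet)
        (fun q hq => by simp [hW, hq])]
    have hint : IntegrableOn (chartDensity G e) K volume :=
      ((hG.continuousOn e he).mono hKsub).integrableOn_compact hKc
    calc ∫⁻ x in e.target, ENNReal.ofReal (chartDensity G e x) *
          W.indicator (1 : L → ℝ≥0∞) (e.symm x)
        ≤ ∫⁻ x in e.target, K.indicator (fun x => ENNReal.ofReal (chartDensity G e x)) x := by
          refine setLIntegral_mono' e.open_target.measurableSet fun x hx => ?_
          by_cases hxW : e.symm x ∈ W
          · have : x ∈ K := by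
              have := interior_subset hxW.2
              rwa [e.right_inv hx] at this
            simp [this, hxW]
          · simp [hxW]
      _ ≤ ∫⁻ x, K.indicator (fun x => ENNReal.ofReal (chartDensity G e x)) x :=
          setLIntegral_le_lintegral _ _
      _ = ∫⁻ x in K, ENNReal.ofReal (chartDensity G e x) :=
          lintegral_indicator hKc.measurableSet _
      _ < ⊤ := hint.lintegral_lt_top
  infer_instance

/-- Naturality of the volume: `G'` is the pullback of `G` by `ψ`, so its density in the chart `e ∘
ψ` equals that of `G` in `e`. -/
theorem map_riemannianVolume
    {G G' : ∀ q : L, TangentSpace (𝓡 n) q → TangentSpace (𝓡 n) q → ℝ}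
    (hG : HasContinuousDensity G) (hG' : HasContinuousDensity G')
    (ψ : Diffeomorph (𝓡 n) (𝓡 n) L L ∞)
    (h : ∀ q (u v : TangentSpace (𝓡 n) q), G' q u v =
      G (ψ q) (mfderiv (𝓡 n) (𝓡 n) ψ q u) (mfderiv (𝓡 n) (𝓡 n) ψ q v)) :
    (riemannianVolume G').map ψ = riemannianVolume G := by
  refine measure_ext_of_charts (n := n) fun p => ?_
  set e := chartAt (EuclideanSpace ℝ (Fin n)) p with he_def
  have he : IsSmoothChart e := isSmoothChart_of_mem_atlas (chart_mem_atlas _ p)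
  -- This chart need not belong to the atlas, which is why the volume formulas are stated for every
  -- `IsSmoothChart`.
  set e' : OpenPartialHomeomorph L (EuclideanSpace ℝ (Fin n)) :=
    ψ.toHomeomorph.toOpenPartialHomeomorph.trans e with he'_def
  have hsrc : e'.source = ψ ⁻¹' e.source := by
    simp [he'_def]
  have htgt : e'.target = e.target := by
    simp [he'_def]
  have hsymm : ∀ x, e'.symm x = ψ.symm (e.symm x) := fun x => rfl
  have he' : IsSmoothChart e' := by
    constructor
    · rw [hsrc]
      exact he.contMDiffOn.comp ψ.contMDiff.contMDiffOn fun x hx => hx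
    · rw [htgt]
      exact ψ.symm.contMDiff.comp_contMDiffOn he.contMDiffOn_symm
  have hψm : Measurable ψ := ψ.continuous.measurable
  rw [restrict_riemannianVolume hG he, Measure.restrict_map hψm e.open_source.measurableSet,
    ← hsrc, restrict_riemannianVolume hG' he', htgt]
  have hsm' := aemeasurable_symm e'
  rw [htgt] at hsm'
  rw [AEMeasurable.map_map_of_aemeasurable hψm.aemeasurable
    (hsm'.mono_ac (withDensity_absolutelyContinuous _ _))]
  have hcomp : ψ ∘ e'.symm = e.symm := by
    funext x
    simp [hsymm]
  rw [hcomp]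
  congr 1
  refine withDensity_congr_ae ?_
  refine (ae_restrict_iff' e.open_target.measurableSet).2 (Eventually.of_forall fun x hx => ?_)
  simp only
  congr 1
  unfold chartDensity
  have hd : ∀ v : EuclideanSpace ℝ (Fin n),
      (mfderiv (𝓡 n) (𝓡 n) e.symm x v : EuclideanSpace ℝ (Fin n)) = mfderiv (𝓡 n) (𝓡 n) ψ (e'.symm x) (mfderiv (𝓡 n) (𝓡 n) e'.symm x v) := by
    intro v
    rw [← hcomp, mfderiv_comp x (ψ.contMDiff.mdifferentiable (by simp) _)
      (he'.mdifferentiableAt_symm (by rwa [htgt]))]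
    rfl
  have hq : ψ (e'.symm x) = e.symm x := congrFun hcomp x
  congr 2
  ext j k
  simp only [Matrix.of_apply]
  rw [h]
  obtain ⟨B, hB⟩ := hG.bilin (e.symm x)
  have hB' : ∀ u v : EuclideanSpace ℝ (Fin n), G (ψ (e'.symm x)) u v = B u v := by
    rw [hq]; exact hB
  refine (hB' _ _).trans (Eq.trans ?_ (hB _ _).symm)
  exact (congrArg₂ (fun u v => B u v) (hd _) (hd _)).symm

end RiemannianVolume

/-! ### Pullbacks of the holomorphic volume form by real smooth maps. -/

section Pullback

open Topology Filter

variable {n : ℕ} {E : Type*} [NormedAddCommGroup E] [NormedSpace ℂ E]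
  {M : Type*} [TopologicalSpace M] [ChartedSpace E M]
  {L : Type*} [TopologicalSpace L] [ChartedSpace (EuclideanSpace ℝ (Fin n)) L]

theorem isManifold_real [IsManifold 𝓘(ℂ, E) ω M] : IsManifold 𝓘(ℝ, E) ∞ M := by
  refine isManifold_of_contDiffOn _ _ _ fun e e' he he' => ?_
  have h := (contDiffGroupoid ω 𝓘(ℂ, E)).compatible he he'
  have h2 : ContDiffOn ℂ ω (e.symm.trans e') (e.symm.trans e').source := by
    simpa [contDiffPregroupoid] using (mem_groupoid_of_pregroupoid.1 h).1
  simpa using (h2.restrict_scalars ℝ).of_le le_top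

/-- Bridges the complex derivative used in `chartForm` for the holomorphic form and the real
derivatives of maps from `L`. -/
theorem hasMFDerivAt_restrictScalars {g : E → M} {y : E}
    (hg : MDifferentiableAt 𝓘(ℂ, E) 𝓘(ℂ, E) g y) :
    HasMFDerivAt 𝓘(ℝ, E) 𝓘(ℝ, E) g y
      ((mfderiv 𝓘(ℂ, E) 𝓘(ℂ, E) g y : E →L[ℂ] E).restrictScalars ℝ) := by
  have h := hg.hasMFDerivAt
  exact ⟨h.1, HasFDerivWithinAt.restrictScalars ℝ h.2⟩

/-- The coefficient of the pullback of the holomorphic volume form under `h`, in the chart `e`. -/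
def pull (X : CalabiYau n E M) (h : L → M)
    (e : OpenPartialHomeomorph L (EuclideanSpace ℝ (Fin n))) (x : EuclideanSpace ℝ (Fin n)) : ℂ :=
  X.vol (h (e.symm x)) (fun k => mfderiv (𝓡 n) 𝓘(ℝ, E) h (e.symm x)
    (mfderiv (𝓡 n) (𝓡 n) e.symm x (coordVec k)))

theorem CalabiYau.vol_congr (X : CalabiYau n E M) {p p' : M} (h : p = p') (v : Fin n → E) :
    X.vol p v = X.vol p' v := by subst h; rfl

theorem contDiffAt_inCharts [IsManifold 𝓘(ℂ, E) ω M] {h : L → M}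
    (hh : ContMDiff (𝓡 n) 𝓘(ℝ, E) ∞ h)
    {e : OpenPartialHomeomorph L (EuclideanSpace ℝ (Fin n))} (he : IsSmoothChart e)
    {e' : OpenPartialHomeomorph M E} (he' : e' ∈ atlas E M) {x : EuclideanSpace ℝ (Fin n)}
    (hx : x ∈ e.target) (hx' : h (e.symm x) ∈ e'.source) :
    ContDiffAt ℝ ∞ (e' ∘ h ∘ e.symm) x := by
  have : IsManifold 𝓘(ℝ, E) ∞ M := isManifold_real
  have h1 : ContMDiffAt 𝓘(ℝ, E) 𝓘(ℝ, E) ∞ e' (h (e.symm x)) :=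
    (contMDiffOn_of_mem_maximalAtlas (IsManifold.subset_maximalAtlas he')).contMDiffAt
      (e'.open_source.mem_nhds hx')
  have h2 := he.contMDiffOn_symm.contMDiffAt (e.open_target.mem_nhds hx)
  exact contMDiffAt_iff_contDiffAt.1 (h1.comp x ((hh _).comp x h2))

/-- The chain rule through the chart `e'`. It reduces questions about `pull` to the model space,
where the coefficients of the form are holomorphic. -/
theorem pull_eq_chartForm [IsManifold 𝓘(ℂ, E) ω M] (X : CalabiYau n E M) {h : L → M}
    (hh : ContMDiff (𝓡 n) 𝓘(ℝ, E) ∞ h)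
    {e : OpenPartialHomeomorph L (EuclideanSpace ℝ (Fin n))} (he : IsSmoothChart e)
    {e' : OpenPartialHomeomorph M E} (he' : e' ∈ atlas E M) {x : EuclideanSpace ℝ (Fin n)}
    (hx : x ∈ e.target) (hx' : h (e.symm x) ∈ e'.source) :
    pull X h e x = chartForm X.vol e' ((e' ∘ h ∘ e.symm) x) (frame (e' ∘ h ∘ e.symm) x) := by
  have hsm := (contDiffAt_inCharts hh he he' hx hx').differentiableAt (by simp)
  have hcd : MDifferentiableAt 𝓘(ℂ, E) 𝓘(ℂ, E) e'.symm ((e' ∘ h ∘ e.symm) x) :=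
    (((contMDiffOn_symm_of_mem_maximalAtlas (IsManifold.subset_maximalAtlas he' :
      e' ∈ IsManifold.maximalAtlas 𝓘(ℂ, E) ω M)).contMDiffAt
      (e'.open_target.mem_nhds (e'.map_source hx')))).mdifferentiableAt (by simp)
  have hrd := hasMFDerivAt_restrictScalars hcd
  have hcomp : HasMFDerivAt (𝓡 n) 𝓘(ℝ, E) (e'.symm ∘ (e' ∘ h ∘ e.symm)) x
      (((mfderiv 𝓘(ℂ, E) 𝓘(ℂ, E) e'.symm ((e' ∘ h ∘ e.symm) x) : E →L[ℂ] E).restrictScalars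
        ℝ).comp (fderiv ℝ (e' ∘ h ∘ e.symm) x)) :=
    hrd.comp x hsm.hasFDerivAt.hasMFDerivAt
  have hev : h ∘ e.symm =ᶠ[𝓝 x] e'.symm ∘ (e' ∘ h ∘ e.symm) := by
    have hc : ContinuousAt (h ∘ e.symm) x :=
      hh.continuous.continuousAt.comp (e.continuousAt_symm hx)
    filter_upwards [hc.preimage_mem_nhds (e'.open_source.mem_nhds hx')] with y hy
    exact (e'.left_inv hy).symm
  have h1 := (hcomp.congr_of_eventuallyEq hev).mfderiv
  have h2 := mfderiv_comp x (hh.mdifferentiable (by simp) (e.symm x))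
    (he.mdifferentiableAt_symm hx)
  rw [h1] at h2
  have h3 : ∀ v : EuclideanSpace ℝ (Fin n),
      (mfderiv (𝓡 n) 𝓘(ℝ, E) h (e.symm x) (mfderiv (𝓡 n) (𝓡 n) e.symm x v) : E) =
      (mfderiv 𝓘(ℂ, E) 𝓘(ℂ, E) e'.symm ((e' ∘ h ∘ e.symm) x) : E →L[ℂ] E)
        (fderiv ℝ (e' ∘ h ∘ e.symm) x v) := fun v => (congrArg (fun T => T v) h2).symm
  unfold pull chartForm
  refine (congrArg (fun w : Fin n → E => X.vol (h (e.symm x)) w)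
    (funext fun k => h3 (coordVec k))).trans ?_
  exact X.vol_congr (e'.left_inv hx').symm _

theorem continuousOn_pull [IsManifold 𝓘(ℂ, E) ω M] (X : CalabiYau n E M) {h : L → M}
    (hh : ContMDiff (𝓡 n) 𝓘(ℝ, E) ∞ h)
    {e : OpenPartialHomeomorph L (EuclideanSpace ℝ (Fin n))} (he : IsSmoothChart e) :
    ContinuousOn (pull X h e) e.target := by
  intro x hx
  refine ContinuousAt.continuousWithinAt ?_
  set e' := chartAt E (h (e.symm x))
  have he' : e' ∈ atlas E M := chart_mem_atlas _ _
  have hx' : h (e.symm x) ∈ e'.source := mem_chart_source _ _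
  have hc : ContinuousAt (h ∘ e.symm) x :=
    hh.continuous.continuousAt.comp (e.continuousAt_symm hx)
  have hev : pull X h e =ᶠ[𝓝 x] fun y =>
      chartForm X.vol e' ((e' ∘ h ∘ e.symm) y) (frame (e' ∘ h ∘ e.symm) y) := by
    filter_upwards [hc.preimage_mem_nhds (e'.open_source.mem_nhds hx'),
      e.open_target.mem_nhds hx] with y hy hy'
    exact pull_eq_chartForm X hh he he' hy' hy
  refine ContinuousAt.congr ?_ hev.symm
  have hsm := contDiffAt_inCharts hh he he' hx hx'
  have hform : ContinuousAt (chartForm X.vol e') ((e' ∘ h ∘ e.symm) x) :=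
    (X.vol_holomorphic e' he').continuousOn.continuousAt
      (e'.open_target.mem_nhds (e'.map_source hx'))
  have h1 : ContinuousAt (fun y => chartForm X.vol e' ((e' ∘ h ∘ e.symm) y)) x :=
    hform.comp (f := e' ∘ h ∘ e.symm) hsm.continuousAt
  have h2 : ContinuousAt (frame (e' ∘ h ∘ e.symm)) x :=
    (contDiffAt_frame (by exact_mod_cast contDiffAt_infty.1 hsm 2)).continuousAt
  exact h1.eval h2

/-- Complex forms of top degree make up a line. -/
theorem alternating_proportional [FiniteDimensional ℂ E] (hE : Module.finrank ℂ E = n)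
    {A : E [⋀^Fin n]→L[ℂ] ℂ} {v : Fin n → E} (hv : A v ≠ 0) (ψ : E [⋀^Fin n]→L[ℂ] ℂ)
    (u : Fin n → E) : ψ u = ψ v / A v * A u := by
  by_cases hn : n = 0
  · subst hn
    rw [Subsingleton.elim u v, div_mul_cancel₀ _ hv]
  have : Nonempty (Fin n) := ⟨⟨0, Nat.pos_of_ne_zero hn⟩⟩
  have hli : LinearIndependent ℂ v := by
    by_contra h
    exact hv (A.toAlternatingMap.map_linearDependent v h)
  let bas := basisOfLinearIndependentOfCardEqFinrank hli (by simp [hE])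
  have hb : ⇑bas = v := by simp [bas]
  have key : ∀ ψ : E [⋀^Fin n]→L[ℂ] ℂ, ψ u = ψ v * bas.det u := by
    intro ψ
    have h3 := congrArg (fun f => f u) (AlternatingMap.eq_smul_basis_det bas ψ.toAlternatingMap)
    simp only [hb, ContinuousAlternatingMap.coe_toAlternatingMap] at h3
    exact h3
  rw [key ψ, key A]
  field_simp

/-- Deforming a map inside a convex piece of a chart does not change the integral of the pullback
of the closed form `f φ`. -/
theorem setIntegral_pull_sub_eq_zero [FiniteDimensional ℂ E] (hE : Module.finrank ℂ E = n)
    [IsManifold 𝓘(ℂ, E) ω M] (X : CalabiYau n E M) {U : Set M} {f : M → ℂ}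
    (hf : ContMDiffOn 𝓘(ℂ, E) 𝓘(ℂ, ℂ) ω f U)
    {h h' : L → M} (hh : ContMDiff (𝓡 n) 𝓘(ℝ, E) ∞ h) (hh' : ContMDiff (𝓡 n) 𝓘(ℝ, E) ∞ h')
    {e : OpenPartialHomeomorph L (EuclideanSpace ℝ (Fin n))} (he : IsSmoothChart e)
    {e' : OpenPartialHomeomorph M E} (he' : e' ∈ atlas E M) {B : Set E} (hB : IsOpen B)
    (hBc : Convex ℝ B) (hBt : B ⊆ e'.target) (hBU : MapsTo e'.symm B U)
    {V K : Set (EuclideanSpace ℝ (Fin n))} (hV : IsOpen V) (hVe : V ⊆ e.target)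
    (hK : IsCompact K) (hKV : K ⊆ V)
    (hhV : ∀ x ∈ V, h (e.symm x) ∈ e'.source ∧ e' (h (e.symm x)) ∈ B)
    (hhV' : ∀ x ∈ V, h' (e.symm x) ∈ e'.source ∧ e' (h' (e.symm x)) ∈ B)
    (heq : ∀ x ∈ V, x ∉ K → h' (e.symm x) = h (e.symm x)) :
    ∫ x in K, (f (h' (e.symm x)) * pull X h' e x - f (h (e.symm x)) * pull X h e x) = 0 := by
  rcases K.eq_empty_or_nonempty with rfl | ⟨x₀, hx₀⟩
  · simp
  -- Any nonzero constant top form would do as `A`; the value of the volume form at a point supplies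
  -- one. On `B` the form `f φ` becomes `F` times `A`, with `F` holomorphic.
  set A : E [⋀^Fin n]→L[ℂ] ℂ := X.vol (h (e.symm x₀)) with hA
  obtain ⟨v, hv⟩ : ∃ v, A v ≠ 0 := by
    by_contra! hcon
    exact X.vol_ne_zero (h (e.symm x₀)) (ContinuousAlternatingMap.ext hcon)
  set F : E → ℂ := fun z => f (e'.symm z) * (chartForm X.vol e' z v / A v) with hF
  have hFc : ContDiffOn ℂ 1 F B := by
    refine ContDiffOn.mul ?_ (ContDiffOn.div_const ?_ _)
    · have h1 : ContMDiffOn 𝓘(ℂ, E) 𝓘(ℂ, E) ω e'.symm B :=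
        (contMDiffOn_symm_of_mem_maximalAtlas (IsManifold.subset_maximalAtlas he')).mono hBt
      exact (contMDiffOn_iff_contDiffOn.1 (hf.comp h1 hBU)).of_le le_top
    · have h1 := ((X.vol_holomorphic e' he').mono hBt).of_le (m := 1) le_top
      exact (ContinuousAlternatingMap.apply ℂ E ℂ v).contDiff.comp_contDiffOn h1
  have hpull : ∀ g : L → M, ContMDiff (𝓡 n) 𝓘(ℝ, E) ∞ g → ∀ x ∈ V,
      g (e.symm x) ∈ e'.source → f (g (e.symm x)) * pull X g e x =
        F ((e' ∘ g ∘ e.symm) x) * A (frame (e' ∘ g ∘ e.symm) x) := by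
    intro g hg x hx hgx
    rw [pull_eq_chartForm X hg he he' (hVe hx) hgx,
      alternating_proportional hE hv (chartForm X.vol e' ((e' ∘ g ∘ e.symm) x))]
    simp only [hF, Function.comp_apply, e'.left_inv hgx]
    ring
  have hsm : ∀ g : L → M, ContMDiff (𝓡 n) 𝓘(ℝ, E) ∞ g →
      (∀ x ∈ V, g (e.symm x) ∈ e'.source) → ContDiffOn ℝ ∞ (e' ∘ g ∘ e.symm) V :=
    fun g hg hgV x hx =>
      (contDiffAt_inCharts hg he he' (hVe hx) (hgV x hx)).contDiffWithinAt
  rw [← setIntegral_pullback_sub_eq_zero hE A hB hBc hFc hV hK hKV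
    (hsm h hh fun x hx => (hhV x hx).1) (hsm h' hh' fun x hx => (hhV' x hx).1)
    (fun x hx => (hhV x hx).2) (fun x hx => (hhV' x hx).2)
    (fun x hx hxK => by simp [heq x hx hxK])]
  refine setIntegral_congr_fun hK.measurableSet fun x hx => ?_
  rw [hpull h hh x (hKV hx) (hhV x (hKV hx)).1, hpull h' hh' x (hKV hx) (hhV' x (hKV hx)).1]

end Pullback

/-! ### The Riemannian density of a special Lagrangian embedding. -/

section Density

open Topology Filter

variable {n : ℕ} {E : Type*} [NormedAddCommGroup E] [NormedSpace ℂ E]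
  {M : Type*} [TopologicalSpace M] [ChartedSpace E M]
  {L : Type*} [TopologicalSpace L] [ChartedSpace (EuclideanSpace ℝ (Fin n)) L]

theorem IsSmoothChart.mdifferentiable {e : OpenPartialHomeomorph L (EuclideanSpace ℝ (Fin n))}
    (he : IsSmoothChart e) : e.MDifferentiable (𝓡 n) (𝓡 n) :=
  ⟨he.contMDiffOn.mdifferentiableOn (by simp), he.contMDiffOn_symm.mdifferentiableOn (by simp)⟩

/-- The Kähler form at `p` as a form on the model space. -/
def CalabiYau.kahlerAt (X : CalabiYau n E M) (p : M) : E [⋀^Fin 2]→L[ℝ] ℝ := X.kahler p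

/-- The holomorphic volume form at `p` as a form on the model space. -/
def CalabiYau.volAt (X : CalabiYau n E M) (p : M) : E [⋀^Fin n]→L[ℂ] ℂ := X.vol p

variable (n E) in
/-- The differential as a map between model spaces. -/
def differential (h : L → M) (q : L) : EuclideanSpace ℝ (Fin n) →L[ℝ] E :=
  mfderiv (𝓡 n) 𝓘(ℝ, E) h q

/-- The value of the pullback of the holomorphic volume form on the standard frame. -/
def pullAt (X : CalabiYau n E M) (h : L → M) (q : L) : ℂ :=
  X.vol (h q) (fun k => (mfderiv (𝓡 n) 𝓘(ℝ, E) h q : EuclideanSpace ℝ (Fin n) →L[ℝ] E)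
    (coordVec k))

theorem alternating_comp_frame (φ : E [⋀^Fin n]→L[ℂ] ℂ) (T : EuclideanSpace ℝ (Fin n) →L[ℝ] E)
    (N : EuclideanSpace ℝ (Fin n) →L[ℝ] EuclideanSpace ℝ (Fin n)) :
    φ (fun j => T (N (coordVec j))) =
      (Matrix.of fun j k : Fin n => ((N (coordVec j) k : ℝ) : ℂ)).det *
        φ (fun k => T (coordVec k)) := by
  rw [← alternatingMap_sum_smul]
  congr 1
  funext j
  have h2 : N (coordVec j) = ∑ k, (N (coordVec j) k) • (coordVec k) := by
    ext i
    simp [Finset.sum_apply, Pi.single_apply]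
  conv_lhs => rw [h2]
  simp only [map_sum, map_smul, Matrix.of_apply, Complex.coe_smul]

/-- The factor `d` is the determinant of the derivative of `e.symm` at `x`. That it does not depend
on `h` is what makes quotients of pullbacks independent of the chart. -/
theorem exists_pull_eq_mul (X : CalabiYau n E M)
    (e : OpenPartialHomeomorph L (EuclideanSpace ℝ (Fin n))) (x : EuclideanSpace ℝ (Fin n)) :
    ∃ d : ℂ, (∀ h : L → M, pull X h e x = d * pullAt X h (e.symm x)) :=
  ⟨_, fun h => alternating_comp_frame (X.volAt (h (e.symm x)))
    (differential n E h (e.symm x)) (mfderiv (𝓡 n) (𝓡 n) e.symm x)⟩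

/-- `pullAt` by itself depends on how each tangent space is identified with the model space and need
not be continuous in `q`. Its quotients agree with those of `pull` in any chart where the latter are
defined, and this gives them an invariant meaning. -/
theorem pull_eq_ratio_mul (X : CalabiYau n E M) (h : L → M) {u : L → M}
    (e : OpenPartialHomeomorph L (EuclideanSpace ℝ (Fin n))) (x : EuclideanSpace ℝ (Fin n))
    (hu : pullAt X u (e.symm x) ≠ 0) :
    pull X h e x = pullAt X h (e.symm x) / pullAt X u (e.symm x) * pull X u e x := by
  obtain ⟨d, hd⟩ := exists_pull_eq_mul X (L := L) e x
  rw [hd, hd]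
  field_simp

/-- In the normal form of an immersion the map is `y ↦ (y, 0)` up to a linear isomorphism, and its
derivative is visibly injective. -/
theorem mfderiv_injective_of_isImmersion [IsManifold 𝓘(ℂ, E) ω M] {h : L → M}
    (hh : ContMDiff (𝓡 n) 𝓘(ℝ, E) ∞ h)
    (hi : Manifold.IsImmersion (𝓡 n) 𝓘(ℝ, E) ∞ h) (q : L) :
    Function.Injective (mfderiv (𝓡 n) 𝓘(ℝ, E) h q : EuclideanSpace ℝ (Fin n) → E) := by
  have hM : IsManifold 𝓘(ℝ, E) ∞ M := isManifold_real
  have hq := hi.isImmersionAt q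
  set d := hq.domChart
  set r := hq.codChart
  have hqd : q ∈ d.source := hq.mem_domChart_source
  have hd : IsSmoothChart d :=
    ⟨contMDiffOn_of_mem_maximalAtlas hq.domChart_mem_maximalAtlas,
      contMDiffOn_symm_of_mem_maximalAtlas hq.domChart_mem_maximalAtlas⟩
  have hr : ContMDiffOn 𝓘(ℝ, E) 𝓘(ℝ, E) ∞ r r.source :=
    contMDiffOn_of_mem_maximalAtlas hq.codChart_mem_maximalAtlas
  have hmem : h q ∈ r.source := hq.mem_codChart_source
  have hw := hq.writtenInCharts
  set x := d q
  have hx : x ∈ d.target := d.map_source hqd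
  have hdx : d.symm x = q := d.left_inv hqd
  have hev : r ∘ h ∘ d.symm =ᶠ[𝓝 x] fun y => hq.equiv (y, 0) := by
    filter_upwards [d.open_target.mem_nhds hx] with y hy
    have := hw (x := y) (by simpa using hy)
    simpa using this
  have hlin : HasFDerivAt (fun y : EuclideanSpace ℝ (Fin n) => hq.equiv (y, 0))
      ((hq.equiv : _ →L[ℝ] E).comp
        (ContinuousLinearMap.inl ℝ (EuclideanSpace ℝ (Fin n)) hq.complement)) x := by
    have := ((hq.equiv : _ →L[ℝ] E).comp
      (ContinuousLinearMap.inl ℝ (EuclideanSpace ℝ (Fin n)) hq.complement)).hasFDerivAt (x := x)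
    exact this
  have h1 : mfderiv (𝓡 n) 𝓘(ℝ, E) (r ∘ h ∘ d.symm) x =
      ((hq.equiv : _ →L[ℝ] E).comp
        (ContinuousLinearMap.inl ℝ (EuclideanSpace ℝ (Fin n)) hq.complement)) := by
    rw [hev.mfderiv_eq]
    exact hlin.hasMFDerivAt.mfderiv
  have hrd : MDifferentiableAt 𝓘(ℝ, E) 𝓘(ℝ, E) r ((h ∘ d.symm) x) := by
    refine (hr.contMDiffAt (r.open_source.mem_nhds ?_)).mdifferentiableAt (by simp)
    simpa [hdx] using hmem
  have hhd : MDifferentiableAt (𝓡 n) 𝓘(ℝ, E) h (d.symm x) := hh.mdifferentiable (by simp) _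
  have hsd := hd.mdifferentiableAt_symm hx
  rw [mfderiv_comp x hrd (hhd.comp x hsd), mfderiv_comp x hhd hsd] at h1
  have hbij := hd.mdifferentiable.symm.mfderiv_bijective hx
  have hval : ∀ v : EuclideanSpace ℝ (Fin n), (mfderiv 𝓘(ℝ, E) 𝓘(ℝ, E) r ((h ∘ d.symm) x)
      (mfderiv (𝓡 n) 𝓘(ℝ, E) h (d.symm x) (mfderiv (𝓡 n) (𝓡 n) d.symm x v)) : E) =
      hq.equiv (v, 0) := fun v => congrArg (fun T => T v) h1
  rw [← hdx]
  intro a b hab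
  obtain ⟨a', rfl⟩ := hbij.2 a
  obtain ⟨b', rfl⟩ := hbij.2 b
  have h2 := hval a'
  have h3 := hval b'
  have h4 : hq.equiv ((a' : EuclideanSpace ℝ (Fin n)), 0) =
      hq.equiv ((b' : EuclideanSpace ℝ (Fin n)), 0) := by
    rw [← h2, ← h3]
    exact congrArg (mfderiv 𝓘(ℝ, E) 𝓘(ℝ, E) r ((h ∘ d.symm) x)) hab
  have h5 : a' = b' := congrArg Prod.fst (hq.equiv.injective h4)
  rw [h5]

/-- Differentials of special Lagrangian embeddings in charts. -/
theorem linearIndependent_frame [IsManifold 𝓘(ℂ, E) ω M] {h : L → M}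
    (hh : ContMDiff (𝓡 n) 𝓘(ℝ, E) ∞ h)
    (hi : Manifold.IsImmersion (𝓡 n) 𝓘(ℝ, E) ∞ h) {N : EuclideanSpace ℝ (Fin n) →L[ℝ]
      EuclideanSpace ℝ (Fin n)} (hN : Function.Injective N) (q : L) :
    LinearIndependent ℝ (fun k => differential n E h q (N (coordVec k))) := by
  have h0 : LinearIndependent ℝ (fun k : Fin n => coordVec k) := by
    have := (EuclideanSpace.basisFun (Fin n) ℝ).toBasis.linearIndependent
    have hb : (fun k : Fin n => coordVec k) =
        ⇑(EuclideanSpace.basisFun (Fin n) ℝ).toBasis := funext fun k => by simp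
    rw [hb]
    exact this
  have h1 := h0.map' (N : EuclideanSpace ℝ (Fin n) →ₗ[ℝ] EuclideanSpace ℝ (Fin n))
    (LinearMap.ker_eq_bot.2 hN)
  exact h1.map' (differential n E h q : EuclideanSpace ℝ (Fin n) →ₗ[ℝ] E)
    (LinearMap.ker_eq_bot.2 (mfderiv_injective_of_isImmersion hh hi q))

variable {X : CalabiYau n E M} {U : Set M} {c : M → ℝ}

theorem SLagEmbedding.pullAt_ne_zero [FiniteDimensional ℂ E] (hE : Module.finrank ℂ E = n)
    [IsManifold 𝓘(ℂ, E) ω M] (i : SLagEmbedding X L U) (q : L) : pullAt X i.toMap q ≠ 0 :=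
  volume_form_ne_zero (X.kahlerAt (i.toMap q)) (X.kahler_pos _) hE (X.volAt (i.toMap q))
    (X.vol_ne_zero _) _ (fun _ _ => i.lagrangian q _ _)
    (linearIndependent_frame i.toMap.contMDiff i.isSmoothEmbedding.isImmersion
      (N := ContinuousLinearMap.id ℝ _) Function.injective_id q)

theorem SLagEmbedding.pullAt_im (i : SLagEmbedding X L U) (q : L) : (pullAt X i.toMap q).im = 0 :=
  i.special q _

theorem SLagEmbedding.pull_im (i : SLagEmbedding X L U)
    (e : OpenPartialHomeomorph L (EuclideanSpace ℝ (Fin n))) (x : EuclideanSpace ℝ (Fin n)) :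
    (pull X i.toMap e x).im = 0 :=
  i.special _ _

theorem SLagEmbedding.pull_ne_zero [FiniteDimensional ℂ E] (hE : Module.finrank ℂ E = n)
    [IsManifold 𝓘(ℂ, E) ω M] (i : SLagEmbedding X L U)
    {e : OpenPartialHomeomorph L (EuclideanSpace ℝ (Fin n))} (he : IsSmoothChart e)
    {x : EuclideanSpace ℝ (Fin n)} (hx : x ∈ e.target) : pull X i.toMap e x ≠ 0 :=
  volume_form_ne_zero (X.kahlerAt (i.toMap (e.symm x))) (X.kahler_pos _) hE
    (X.volAt (i.toMap (e.symm x)))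
    (X.vol_ne_zero _) _ (fun _ _ => i.lagrangian _ _ _)
    (linearIndependent_frame i.toMap.contMDiff i.isSmoothEmbedding.isImmersion
      (he.mdifferentiable.symm.mfderiv_injective hx) (e.symm x))

/-- On a special Lagrangian submanifold the Riemannian density is the length of the
holomorphic volume form. -/
theorem SLagEmbedding.chartDensity_inducedMetric [IsManifold 𝓘(ℂ, E) ω M]
    (hc : X.IsNormalizing c) (i : SLagEmbedding X L U)
    {e : OpenPartialHomeomorph L (EuclideanSpace ℝ (Fin n))} (he : IsSmoothChart e)
    {x : EuclideanSpace ℝ (Fin n)} (hx : x ∈ e.target) :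
    chartDensity (i.inducedMetric c) e x = ‖pull X i.toMap e x‖ := by
  have h := det_gram_eq_norm_sq (X.kahlerAt (i.toMap (e.symm x))) (X.kahler_invariant _)
    (X.kahler_pos _) (X.volAt (i.toMap (e.symm x))) (hc _).1 (hc _).2 _
    (fun _ _ => i.lagrangian _ _ _)
    (linearIndependent_frame i.toMap.contMDiff i.isSmoothEmbedding.isImmersion
      (he.mdifferentiable.symm.mfderiv_injective hx) (e.symm x))
  unfold chartDensity
  refine Eq.trans (congrArg Real.sqrt h) ?_
  exact Real.sqrt_sq (norm_nonneg _)

theorem SLagEmbedding.isBilinear (i : SLagEmbedding X L U) (c : M → ℝ) :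
    IsBilinear (i.inducedMetric c) := by
  intro q
  set T := differential n E i.toMap q
  set J : E →ₗ[ℝ] E := (LinearMap.lsmul ℂ E Complex.I).restrictScalars ℝ
  exact ⟨c (i.toMap q) • (formBilin (X.kahlerAt (i.toMap q))).compl₁₂
    (T : EuclideanSpace ℝ (Fin n) →ₗ[ℝ] E) (J ∘ₗ (T : EuclideanSpace ℝ (Fin n) →ₗ[ℝ] E)),
    fun u v => rfl⟩

/-- No regularity of `c` enters: the density equals `‖pull‖`, which is continuous because the
holomorphic form and the embedding are. -/
theorem SLagEmbedding.hasContinuousDensity [IsManifold 𝓘(ℂ, E) ω M]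
    (hc : X.IsNormalizing c) (i : SLagEmbedding X L U) :
    HasContinuousDensity (i.inducedMetric c) :=
  ⟨i.isBilinear c, fun _ he => ((continuousOn_pull X i.toMap.contMDiff he).norm).congr
    fun _ hx => i.chartDensity_inducedMetric hc he hx⟩

end Density

/-! ### The integral of `f φ` relative to a reference embedding. -/

section RelativeIntegrand

open Topology Filter

variable {n : ℕ} {E : Type*} [NormedAddCommGroup E] [NormedSpace ℂ E]
  {M : Type*} [TopologicalSpace M] [ChartedSpace E M]
  {L : Type*} [TopologicalSpace L] [ChartedSpace (EuclideanSpace ℝ (Fin n)) L]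
  {X : CalabiYau n E M} {U : Set M} {c : M → ℝ} {f : M → ℂ}

theorem continuous_comp_of_forall_mem {h : L → M} (hh : Continuous h) (hhU : ∀ q, h q ∈ U)
    (hf : ContMDiffOn 𝓘(ℂ, E) 𝓘(ℂ, ℂ) ω f U) : Continuous fun q => f (h q) :=
  hf.continuousOn.comp_continuous hh hhU

/-- The integrand, relative to the Riemannian volume of `u`, of the integral over `h` of the
form `f φ`. -/
def relativeIntegrand (X : CalabiYau n E M) (f : M → ℂ) (u h : L → M) (q : L) : ℂ :=
  f (h q) * (pullAt X h q / pullAt X u q)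

theorem relativeIntegrand_symm [FiniteDimensional ℂ E] (hE : Module.finrank ℂ E = n)
    [IsManifold 𝓘(ℂ, E) ω M] (u : SLagEmbedding X L U) (h : L → M)
    {e : OpenPartialHomeomorph L (EuclideanSpace ℝ (Fin n))} (he : IsSmoothChart e)
    {x : EuclideanSpace ℝ (Fin n)} (hx : x ∈ e.target) :
    relativeIntegrand X f u.toMap h (e.symm x) =
      f (h (e.symm x)) * pull X h e x / pull X u.toMap e x := by
  have h1 := u.pull_ne_zero hE he hx
  rw [relativeIntegrand, pull_eq_ratio_mul X h e x (u.pullAt_ne_zero hE (e.symm x))]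
  field_simp

/-- Continuity is checked in a chart, where the quotient of values of `pullAt` becomes a quotient of
the continuous functions `pull`. -/
theorem continuous_relativeIntegrand [FiniteDimensional ℂ E] (hE : Module.finrank ℂ E = n)
    [IsManifold 𝓘(ℂ, E) ω M] [IsManifold (𝓡 n) ∞ L]
    (hf : ContMDiffOn 𝓘(ℂ, E) 𝓘(ℂ, ℂ) ω f U)
    (u : SLagEmbedding X L U) {h : L → M} (hh : ContMDiff (𝓡 n) 𝓘(ℝ, E) ∞ h)
    (hhU : ∀ q, h q ∈ U) : Continuous (relativeIntegrand X f u.toMap h) := by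
  rw [continuous_iff_continuousAt]
  intro q
  set e := chartAt (EuclideanSpace ℝ (Fin n)) q
  have he : IsSmoothChart e := isSmoothChart_of_mem_atlas (chart_mem_atlas _ q)
  have hq : q ∈ e.source := mem_chart_source _ q
  have h1 : ContinuousOn (fun x => f (h (e.symm x)) * pull X h e x / pull X u.toMap e x)
      e.target :=
    (((continuous_comp_of_forall_mem hh.continuous hhU hf).comp_continuousOn
      e.continuousOn_symm).mul (continuousOn_pull X hh he)).div
      (continuousOn_pull X u.toMap.contMDiff he) fun x hx => u.pull_ne_zero hE he hx
  have h2 := (h1.continuousAt (e.open_target.mem_nhds (e.map_source hq))).comp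
    (e.continuousAt hq)
  refine h2.congr ?_
  filter_upwards [e.open_source.mem_nhds hq] with q' hq'
  rw [Function.comp_apply, ← relativeIntegrand_symm hE u h he (e.map_source hq'),
    e.left_inv hq']

theorem pullAt_congr (X : CalabiYau n E M) {h h' : L → M} {q : L} (hq : h' =ᶠ[𝓝 q] h) :
    pullAt X h' q = pullAt X h q := by
  have h1 : (mfderiv (𝓡 n) 𝓘(ℝ, E) h' q : EuclideanSpace ℝ (Fin n) →L[ℝ] E) =
      mfderiv (𝓡 n) 𝓘(ℝ, E) h q := hq.mfderiv_eq
  unfold pullAt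
  rw [h1]
  exact X.vol_congr hq.self_of_nhds _

/-- A nowhere zero continuous real function keeps its sign on a preconnected set. This local sign
takes the place of an orientation. -/
theorem exists_sign {Y : Type*} [TopologicalSpace Y] {V : Set Y} (hV : IsPreconnected V)
    {g : Y → ℂ} (hg : ContinuousOn g V) (him : ∀ x ∈ V, (g x).im = 0) (h0 : ∀ x ∈ V, g x ≠ 0) :
    ∃ σ : ℂ, ∀ x ∈ V, (‖g x‖ : ℂ) = σ * g x := by
  have hre : ContinuousOn (fun x => (g x).re) V := Complex.continuous_re.comp_continuousOn hg
  have hgre : ∀ x ∈ V, g x = ((g x).re : ℂ) := fun x hx => Complex.ext rfl (by simp [him x hx])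
  have hne : ∀ x ∈ V, (g x).re ≠ 0 := fun x hx h => h0 x hx (by rw [hgre x hx, h]; simp)
  have hnorm : ∀ x ∈ V, ‖g x‖ = |(g x).re| := fun x hx => by
    conv_lhs => rw [hgre x hx]
    rw [Complex.norm_real, Real.norm_eq_abs]
  by_cases hneg : ∃ a ∈ V, (g a).re < 0
  · obtain ⟨a, ha, hga⟩ := hneg
    refine ⟨-1, fun x hx => ?_⟩
    have hx0 : (g x).re < 0 := by
      by_contra hcon
      obtain ⟨y, hy, hy0⟩ := hV.intermediate_value ha hx hre ⟨hga.le, not_lt.1 hcon⟩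
      exact hne y hy hy0
    rw [hnorm x hx, abs_of_neg hx0]
    conv_rhs => rw [hgre x hx]
    push_cast; ring
  · push Not at hneg
    refine ⟨1, fun x hx => ?_⟩
    rw [hnorm x hx, abs_of_nonneg (hneg x hx), one_mul]
    exact (hgre x hx).symm

variable [T2Space L] [CompactSpace L] [IsManifold (𝓡 n) ∞ L] [MeasurableSpace L] [BorelSpace L]

theorem SLagEmbedding.integrable_of_continuous [IsManifold 𝓘(ℂ, E) ω M] (hc : X.IsNormalizing c)
    (i : SLagEmbedding X L U) {g : L → ℂ} (hg : Continuous g) :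
    Integrable g (riemannianVolume (i.inducedMetric c)) := by
  have := isFiniteMeasure_riemannianVolume (i.hasContinuousDensity hc)
  exact hg.integrable_of_hasCompactSupport (HasCompactSupport.of_compactSpace g)

/-- The two integrands differ only over `K`. There the density of `u` is `σ` times its pullback
coefficient, which cancels the denominator and leaves `σ` times the coordinate integral of `f φ`, so
the homotopy lemma applies. -/
theorem integral_relativeIntegrand_eq_of_deformation [FiniteDimensional ℂ E]
    (hE : Module.finrank ℂ E = n) [IsManifold 𝓘(ℂ, E) ω M] (hc : X.IsNormalizing c)
    (hf : ContMDiffOn 𝓘(ℂ, E) 𝓘(ℂ, ℂ) ω f U) (u : SLagEmbedding X L U)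
    {h h' : L → M} (hh : ContMDiff (𝓡 n) 𝓘(ℝ, E) ∞ h) (hh' : ContMDiff (𝓡 n) 𝓘(ℝ, E) ∞ h')
    (hhU : ∀ q, h q ∈ U) (hhU' : ∀ q, h' q ∈ U)
    {e : OpenPartialHomeomorph L (EuclideanSpace ℝ (Fin n))} (he : IsSmoothChart e)
    {e' : OpenPartialHomeomorph M E} (he' : e' ∈ atlas E M) {B : Set E} (hB : IsOpen B)
    (hBc : Convex ℝ B) (hBt : B ⊆ e'.target) (hBU : MapsTo e'.symm B U)
    {V K : Set (EuclideanSpace ℝ (Fin n))} (hV : IsOpen V) (hVc : IsPreconnected V)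
    (hVe : V ⊆ e.target) (hK : IsCompact K) (hKV : K ⊆ V)
    (hhV : ∀ x ∈ V, h (e.symm x) ∈ e'.source ∧ e' (h (e.symm x)) ∈ B)
    (hhV' : ∀ x ∈ V, h' (e.symm x) ∈ e'.source ∧ e' (h' (e.symm x)) ∈ B)
    (heq : ∀ q, q ∉ e.symm '' K → h' q = h q) :
    ∫ q, relativeIntegrand X f u.toMap h' q ∂(riemannianVolume (u.inducedMetric c)) =
      ∫ q, relativeIntegrand X f u.toMap h q ∂(riemannianVolume (u.inducedMetric c)) := by
  have hKe : K ⊆ e.target := hKV.trans hVe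
  have hcl : IsClosed (e.symm '' K) :=
    (hK.image_of_continuousOn (e.continuousOn_symm.mono hKe)).isClosed
  have hc1 := continuous_relativeIntegrand hE hf u hh hhU
  have hc2 := continuous_relativeIntegrand hE hf u hh' hhU'
  have h0 : ∀ q, q ∉ e.symm '' K → relativeIntegrand X f u.toMap h' q -
      relativeIntegrand X f u.toMap h q = 0 := by
    intro q hq
    have hev : h' =ᶠ[𝓝 q] h := by
      filter_upwards [hcl.isOpen_compl.mem_nhds hq] with q' hq' using heq q' hq'
    rw [relativeIntegrand, relativeIntegrand, pullAt_congr X hev, heq q hq, sub_self]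
  have hmemK : ∀ x ∈ e.target, x ∉ K → e.symm x ∉ e.symm '' K := by
    rintro x hx hxK ⟨y, hy, hyx⟩
    exact hxK (e.symm.injOn (hKe hy) hx hyx ▸ hy)
  obtain ⟨σ, hσ⟩ := exists_sign hVc ((continuousOn_pull X u.toMap.contMDiff he).mono hVe)
    (fun x _ => u.pull_im e x) (fun x hx => u.pull_ne_zero hE he (hVe hx))
  rw [← sub_eq_zero, ← integral_sub (u.integrable_of_continuous hc hc2)
    (u.integrable_of_continuous hc hc1),
    ← setIntegral_eq_integral_of_forall_compl_eq_zero (s := e.source) (fun q hq => h0 q ?_),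
    setIntegral_riemannianVolume (g := fun q => relativeIntegrand X f u.toMap h' q -
      relativeIntegrand X f u.toMap h q) (u.hasContinuousDensity hc) he (hc2.sub hc1).aestronglyMeasurable,
    setIntegral_eq_of_subset_of_forall_sdiff_eq_zero e.open_target.measurableSet hKe
      (fun x hx => by rw [h0 _ (hmemK x hx.1 hx.2), smul_zero])]
  · rw [setIntegral_congr_fun hK.measurableSet (g := fun x =>
      σ * (f (h' (e.symm x)) * pull X h' e x - f (h (e.symm x)) * pull X h e x)),
      integral_const_mul, setIntegral_pull_sub_eq_zero hE X hf hh hh' he he' hB hBc hBt hBU hV hVe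
        hK hKV hhV hhV' (fun x hx hxK => heq _ (hmemK x (hVe hx) hxK)), mul_zero]
    intro x hx
    have hx' := hKe hx
    have hne := u.pull_ne_zero hE he hx'
    simp only
    rw [u.chartDensity_inducedMetric hc he hx', relativeIntegrand_symm hE u h he hx',
      relativeIntegrand_symm hE u h' he hx', Complex.real_smul, hσ x (hKV hx)]
    field_simp
  · rintro ⟨y, hy, rfl⟩
    exact hq (e.map_target (hKe hy))

/-- The integral of `f` only depends on the submanifold. -/
theorem SLagEmbedding.integral_reparametrization [IsManifold 𝓘(ℂ, E) ω M]
    (hc : X.IsNormalizing c) (hf : ContMDiffOn 𝓘(ℂ, E) 𝓘(ℂ, ℂ) ω f U)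
    (i j : SLagEmbedding X L U) (ψ : Diffeomorph (𝓡 n) (𝓡 n) L L ∞)
    (hψ : ∀ q, j.toMap q = i.toMap (ψ q)) :
    ∫ q, f (j.toMap q) ∂(riemannianVolume (j.inducedMetric c)) =
      ∫ q, f (i.toMap q) ∂(riemannianVolume (i.inducedMetric c)) := by
  have hcomp : (j.toMap : L → M) = i.toMap ∘ ψ := funext hψ
  rw [← map_riemannianVolume (i.hasContinuousDensity hc) (j.hasContinuousDensity hc) ψ, integral_map]
  · simp [hψ]
  · exact ψ.continuous.measurable.aemeasurable
  · exact (continuous_comp_of_forall_mem i.toMap.contMDiff.continuous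
      (fun q => i.range_subset ⟨q, rfl⟩) hf).aestronglyMeasurable
  · intro q u v
    have h1 : ∀ v : EuclideanSpace ℝ (Fin n), differential n E j.toMap q v =
        differential n E i.toMap (ψ q) (mfderiv (𝓡 n) (𝓡 n) ψ q v) := by
      intro v
      have h2 := mfderiv_comp q (i.toMap.contMDiff.mdifferentiable (by simp) (ψ q))
        (ψ.contMDiff.mdifferentiable (by simp) q)
      rw [← hcomp] at h2
      exact congrArg (fun T => T v) h2
    change c (j.toMap q) * X.metric (j.toMap q) (differential n E j.toMap q u)
      (differential n E j.toMap q v) = c (i.toMap (ψ q)) * X.metric (i.toMap (ψ q))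
      (differential n E i.toMap (ψ q) (mfderiv (𝓡 n) (𝓡 n) ψ q u))
      (differential n E i.toMap (ψ q) (mfderiv (𝓡 n) (𝓡 n) ψ q v))
    exact (congrArg₂ (fun a b : E => c (j.toMap q) * X.metric (j.toMap q) a b) (h1 u) (h1 v)).trans
      (congrArg (fun p => c p * X.metric p _ _) (hψ q))

end RelativeIntegrand

/-! ### Patches and linear deformations inside them. -/

section Patches

open Topology Filter

variable {n : ℕ} {E : Type*} [NormedAddCommGroup E] [NormedSpace ℂ E]
  {M : Type*} [TopologicalSpace M] [ChartedSpace E M]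
  {L : Type*} [TopologicalSpace L] [ChartedSpace (EuclideanSpace ℝ (Fin n)) L]

/-- A region of `L` in which maps close to `u` can be deformed linearly, inside a chart of `M`. -/
structure Patch (n : ℕ) {E : Type*} [NormedAddCommGroup E] [NormedSpace ℂ E]
    {M : Type*} [TopologicalSpace M] [ChartedSpace E M]
    {L : Type*} [TopologicalSpace L] [ChartedSpace (EuclideanSpace ℝ (Fin n)) L]
    (u : L → M) (U : Set M) where
  /-- the chart of the source -/
  e : OpenPartialHomeomorph L (EuclideanSpace ℝ (Fin n))
  isSmoothChart : IsSmoothChart e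
  /-- the chart of the target -/
  e' : OpenPartialHomeomorph M E
  mem_atlas : e' ∈ atlas E M
  /-- the convex region in the chart of the target -/
  B : Set E
  isOpen_B : IsOpen B
  convex_B : Convex ℝ B
  B_subset : B ⊆ e'.target
  mapsTo_B : MapsTo e'.symm B U
  /-- the region in the chart of the source -/
  V : Set (EuclideanSpace ℝ (Fin n))
  isOpen_V : IsOpen V
  isPreconnected_V : IsPreconnected V
  V_subset : V ⊆ e.target
  /-- the support of the deformation -/
  K : Set (EuclideanSpace ℝ (Fin n))
  isCompact_K : IsCompact K
  K_subset : K ⊆ V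
  /-- a compact neighbourhood of the region -/
  C : Set L
  isCompact_C : IsCompact C
  V_subset_C : MapsTo e.symm V C
  map_C : ∀ q ∈ C, u q ∈ e'.source ∧ e' (u q) ∈ B
  /-- the cutoff function -/
  χ : L → ℝ
  smooth_χ : ContMDiff (𝓡 n) 𝓘(ℝ, ℝ) ∞ χ
  χ_mem : ∀ q, χ q ∈ Icc (0 : ℝ) 1
  χ_eq_zero : ∀ q, q ∉ e.symm '' K → χ q = 0

/-- Concentric balls around `q₀` in a chart provide all the regions, with `ρ` so small that the
closed ball of radius `ρ` is sent by `u` into a ball `B` of a chart of `M` lying over `U`. -/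
theorem exists_patch [T2Space L] [CompactSpace L] [IsManifold (𝓡 n) ∞ L]
    {u : L → M} (hu : Continuous u) {U : Set M} (hU : IsOpen U) (huU : ∀ q, u q ∈ U) (q₀ : L) :
    ∃ P : Patch (E := E) n u U, ∀ᶠ q in 𝓝 q₀, P.χ q = 1 := by
  set e := chartAt (EuclideanSpace ℝ (Fin n)) q₀ with he_def
  set e' := chartAt E (u q₀) with he'_def
  have hq₀ : q₀ ∈ e.source := mem_chart_source _ _
  have huq₀ : u q₀ ∈ e'.source := mem_chart_source _ _
  have hopen : IsOpen (e'.target ∩ e'.symm ⁻¹' U) := e'.isOpen_inter_preimage_symm hU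
  obtain ⟨r, hr, hrB⟩ := Metric.isOpen_iff.1 hopen (e' (u q₀))
    ⟨e'.map_source huq₀, by simpa [e'.left_inv huq₀] using huU q₀⟩
  set B := Metric.ball (e' (u q₀)) r
  have hO : IsOpen (u ⁻¹' (e'.source ∩ e' ⁻¹' B)) :=
    (e'.isOpen_inter_preimage Metric.isOpen_ball).preimage hu
  have hO2 : IsOpen (e.target ∩ e.symm ⁻¹' (u ⁻¹' (e'.source ∩ e' ⁻¹' B))) :=
    e.isOpen_inter_preimage_symm hO
  have hx₀ : e q₀ ∈ e.target ∩ e.symm ⁻¹' (u ⁻¹' (e'.source ∩ e' ⁻¹' B)) := by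
    refine ⟨e.map_source hq₀, ?_⟩
    simp only [mem_preimage, e.left_inv hq₀]
    exact ⟨huq₀, Metric.mem_ball_self hr⟩
  obtain ⟨ρ, hρ, hρB⟩ := Metric.nhds_basis_closedBall.mem_iff.1 (hO2.mem_nhds hx₀)
  have hVe : Metric.closedBall (e q₀) ρ ⊆ e.target := fun x hx => (hρB hx).1
  -- The radii are nested as `ρ / 4 < ρ / 2 < ρ`: the cutoff equals `1` near `q₀`, lives in the
  -- compact ball `K` of radius `ρ / 2`, and `K` has the convex neighbourhood `V` of radius `ρ`.
  let bump : SmoothBumpFunction (𝓡 n) q₀ :=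
    { rIn := ρ / 4, rOut := ρ / 2, rIn_pos := by positivity, rIn_lt_rOut := by linarith
      closedBall_subset := by
        refine inter_subset_left.trans
          ((Metric.closedBall_subset_closedBall (ε₂ := ρ) ?_).trans ?_)
        · linarith
        · simpa using hVe }
  refine ⟨{ e := e, isSmoothChart := isSmoothChart_of_mem_atlas (chart_mem_atlas _ _), e' := e'
            mem_atlas := chart_mem_atlas _ _, B := B, isOpen_B := Metric.isOpen_ball
            convex_B := convex_ball _ _, B_subset := fun x hx => (hrB hx).1
            mapsTo_B := fun x hx => (hrB hx).2
            V := Metric.ball (e q₀) ρ, isOpen_V := Metric.isOpen_ball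
            isPreconnected_V := (convex_ball _ _).isPreconnected
            V_subset := Metric.ball_subset_closedBall.trans hVe
            K := Metric.closedBall (e q₀) (ρ / 2)
            isCompact_K := isCompact_closedBall _ _
            K_subset := Metric.closedBall_subset_ball (by linarith)
            C := e.symm '' Metric.closedBall (e q₀) ρ
            isCompact_C := (isCompact_closedBall _ _).image_of_continuousOn
              (e.continuousOn_symm.mono hVe)
            V_subset_C := fun x hx => ⟨x, Metric.ball_subset_closedBall hx, rfl⟩
            map_C := ?_
            χ := bump, smooth_χ := bump.contMDiff, χ_mem := fun q => bump.mem_Icc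
            χ_eq_zero := ?_ }, ?_⟩
  · rintro _ ⟨x, hx, rfl⟩
    exact (hρB hx).2
  · intro q hq
    by_contra h0
    have : q ∈ Function.support bump := h0
    rw [bump.support_eq_inter_preimage] at this
    refine hq ⟨e q, Metric.ball_subset_closedBall ?_, e.left_inv this.1⟩
    simpa [bump] using this.2
  · exact bump.eventuallyEq_one

variable {u : L → M} {U : Set M}

open Classical in
/-- The linear deformation of `h` towards `v` in a patch. -/
def Patch.deform (P : Patch (E := E) n u U) (h v : L → M) (q : L) : M :=
  if q ∈ P.e.symm '' P.K then P.e'.symm ((1 - P.χ q) • P.e' (h q) + P.χ q • P.e' (v q)) else h q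

theorem Patch.isClosed_support [T2Space L] (P : Patch (E := E) n u U) :
    IsClosed (P.e.symm '' P.K) :=
  (P.isCompact_K.image_of_continuousOn
    (P.e.continuousOn_symm.mono (P.K_subset.trans P.V_subset))).isClosed

/-- The maps `h` which stay in the chart on the region of the patch. -/
def Patch.Admissible (P : Patch (E := E) n u U) (h : L → M) : Prop :=
  ∀ q ∈ P.C, h q ∈ P.e'.source ∧ P.e' (h q) ∈ P.B

theorem Patch.image_K_subset (P : Patch (E := E) n u U) : P.e.symm '' P.K ⊆ P.C := by
  rintro _ ⟨x, hx, rfl⟩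
  exact P.V_subset_C (P.K_subset hx)

/-- Since the cutoff vanishes off `K`, the two branches agree on the rest of `C`; one smooth formula
thus covers a whole neighbourhood of the support. -/
theorem Patch.deform_of_mem (P : Patch (E := E) n u U) {h : L → M} (hh : P.Admissible h)
    (v : L → M) {q : L} (hq : q ∈ P.C) :
    P.deform h v q = P.e'.symm ((1 - P.χ q) • P.e' (h q) + P.χ q • P.e' (v q)) := by
  by_cases hK : q ∈ P.e.symm '' P.K
  · simp [Patch.deform, hK]
  · simp [Patch.deform, hK, P.χ_eq_zero q hK, P.e'.left_inv (hh q hq).1]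

theorem Patch.deform_of_notMem (P : Patch (E := E) n u U) (h v : L → M) {q : L}
    (hq : q ∉ P.e.symm '' P.K) : P.deform h v q = h q := by
  simp only [Patch.deform, hq, if_false]

theorem Patch.combination_mem (P : Patch (E := E) n u U) {h v : L → M} (hh : P.Admissible h)
    (hv : P.Admissible v) {q : L} (hq : q ∈ P.C) :
    (1 - P.χ q) • P.e' (h q) + P.χ q • P.e' (v q) ∈ P.B :=
  P.convex_B (hh q hq).2 (hv q hq).2 (sub_nonneg.2 (P.χ_mem q).2) (P.χ_mem q).1 (by ring)

theorem Patch.admissible_deform (P : Patch (E := E) n u U) {h v : L → M} (hh : P.Admissible h)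
    (hv : P.Admissible v) : P.Admissible (P.deform h v) := by
  intro q hq
  have hB := P.combination_mem hh hv hq
  rw [P.deform_of_mem hh v hq]
  exact ⟨P.e'.map_target (P.B_subset hB), by rwa [P.e'.right_inv (P.B_subset hB)]⟩

theorem Patch.deform_mem (P : Patch (E := E) n u U) {h v : L → M} (hh : P.Admissible h)
    (hv : P.Admissible v) (hhU : ∀ q, h q ∈ U) (q : L) : P.deform h v q ∈ U := by
  by_cases hK : q ∈ P.e.symm '' P.K
  · have hq := P.image_K_subset hK
    rw [P.deform_of_mem hh v hq]
    exact P.mapsTo_B (P.combination_mem hh hv hq)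
  · rw [P.deform_of_notMem h v hK]
    exact hhU q

/-- Besides reaching the target where the cutoff is `1`, a deformation does not spoil points already
there, since it interpolates between equal values. The induction over patches rests on this. -/
theorem Patch.deform_eq_right (P : Patch (E := E) n u U) {h v : L → M} (hh : P.Admissible h)
    (hv : P.Admissible v) {q : L} (hq : h q = v q ∨ P.χ q = 1) : P.deform h v q = v q := by
  by_cases hK : q ∈ P.e.symm '' P.K
  · have hqC := P.image_K_subset hK
    rw [P.deform_of_mem hh v hqC]
    have : (1 - P.χ q) • P.e' (h q) + P.χ q • P.e' (v q) = P.e' (v q) := by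
      rcases hq with hq | hq
      · rw [hq, ← add_smul]; simp
      · simp [hq]
    rw [this, P.e'.left_inv (hv q hqC).1]
  · rw [P.deform_of_notMem h v hK]
    rcases hq with hq | hq
    · exact hq
    · rw [P.χ_eq_zero q hK] at hq
      simp at hq

theorem Patch.contMDiff_deform [T2Space L] [IsManifold 𝓘(ℂ, E) ω M] (P : Patch (E := E) n u U)
    {h v : L → M} (hh : P.Admissible h)
    (hv : P.Admissible v) (hhs : ContMDiff (𝓡 n) 𝓘(ℝ, E) ∞ h)
    (hvs : ContMDiff (𝓡 n) 𝓘(ℝ, E) ∞ v) : ContMDiff (𝓡 n) 𝓘(ℝ, E) ∞ (P.deform h v) := by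
  have hM : IsManifold 𝓘(ℝ, E) ∞ M := isManifold_real
  intro q
  by_cases hK : q ∈ P.e.symm '' P.K
  · obtain ⟨x, hx, rfl⟩ := hK
    have hxt : x ∈ P.e.target := P.V_subset (P.K_subset hx)
    set q := P.e.symm x
    have hN : ∀ᶠ q' in 𝓝 q, q' ∈ P.C := by
      have h1 : P.e.source ∩ P.e ⁻¹' P.V ∈ 𝓝 q :=
        (P.e.isOpen_inter_preimage P.isOpen_V).mem_nhds ⟨P.e.map_target hxt, by
          simpa [q, P.e.right_inv hxt] using P.K_subset hx⟩
      filter_upwards [h1] with q' hq'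
      have := P.V_subset_C hq'.2
      rwa [P.e.left_inv hq'.1] at this
    have hqC : q ∈ P.C := hN.self_of_nhds
    have hev : P.deform h v =ᶠ[𝓝 q] fun q =>
        P.e'.symm ((1 - P.χ q) • P.e' (h q) + P.χ q • P.e' (v q)) := by
      filter_upwards [hN] with q' hq' using P.deform_of_mem hh v hq'
    refine ContMDiffAt.congr_of_eventuallyEq ?_ hev
    have he'1 : ∀ p ∈ P.e'.source, ContMDiffAt 𝓘(ℝ, E) 𝓘(ℝ, E) ∞ P.e' p := fun p hp =>
      (contMDiffOn_of_mem_maximalAtlas (IsManifold.subset_maximalAtlas P.mem_atlas)).contMDiffAt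
        (P.e'.open_source.mem_nhds hp)
    have he'2 : ∀ p ∈ P.e'.target, ContMDiffAt 𝓘(ℝ, E) 𝓘(ℝ, E) ∞ P.e'.symm p := fun p hp =>
      (contMDiffOn_symm_of_mem_maximalAtlas
        (IsManifold.subset_maximalAtlas P.mem_atlas)).contMDiffAt
        (P.e'.open_target.mem_nhds hp)
    have h1 : ContMDiffAt (𝓡 n) 𝓘(ℝ, E) ∞ (fun q => P.e' (h q)) q :=
      (he'1 _ (hh q hqC).1).comp q (hhs q)
    have h2 : ContMDiffAt (𝓡 n) 𝓘(ℝ, E) ∞ (fun q => P.e' (v q)) q :=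
      (he'1 _ (hv q hqC).1).comp q (hvs q)
    have h3 : ContMDiffAt (𝓡 n) 𝓘(ℝ, E) ∞
        (fun q => (1 - P.χ q) • P.e' (h q) + P.χ q • P.e' (v q)) q :=
      ((contMDiffAt_const.sub (P.smooth_χ q)).smul h1).add ((P.smooth_χ q).smul h2)
    exact (he'2 _ (P.B_subset (P.combination_mem hh hv hqC))).comp q h3
  · refine (hhs q).congr_of_eventuallyEq ?_
    filter_upwards [P.isClosed_support.isOpen_compl.mem_nhds hK] with q' hq'
      using P.deform_of_notMem h v hq'

theorem Patch.admissible_self (P : Patch (E := E) n u U) : P.Admissible u := P.map_C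

theorem Patch.deform_self (P : Patch (E := E) n u U) : P.deform u u = u :=
  funext fun _ => P.deform_eq_right P.admissible_self P.admissible_self (Or.inl rfl)

/-- Admissibility is an open condition at each point of the compact set `C`, so the tube lemma
applies; continuity is required only over the base parameter. -/
theorem Patch.eventually_admissible (P : Patch (E := E) n u U) {A : Type*} [TopologicalSpace A]
    {a₀ : A} {F : A → L → M} (hF₀ : F a₀ = u)
    (hF : ∀ q, ContinuousAt (Function.uncurry F) (a₀, q)) : ∀ᶠ a in 𝓝 a₀, P.Admissible (F a) := by
  refine P.isCompact_C.eventually_forall_of_forall_eventually fun q hq => ?_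
  have hopen : IsOpen (P.e'.source ∩ P.e' ⁻¹' P.B) := P.e'.isOpen_inter_preimage P.isOpen_B
  exact (hF q).eventually (hopen.mem_nhds (by
    simpa [Function.uncurry, hF₀] using P.map_C q hq))

theorem Patch.continuousAt_deform [T2Space L] (P : Patch (E := E) n u U) {A : Type*}
    [TopologicalSpace A]
    {a₀ : A} {F G : A → L → M} (hF₀ : F a₀ = u) (hG₀ : G a₀ = u)
    (hF : ∀ q, ContinuousAt (Function.uncurry F) (a₀, q))
    (hG : ∀ q, ContinuousAt (Function.uncurry G) (a₀, q)) (q : L) :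
    ContinuousAt (Function.uncurry fun a => P.deform (F a) (G a)) (a₀, q) := by
  have hval : P.deform (F a₀) (G a₀) q = u q := by rw [hF₀, hG₀, P.deform_self]
  by_cases hK : q ∈ P.e.symm '' P.K
  · have hqC := P.image_K_subset hK
    have hsrc := (P.map_C q hqC).1
    have h1 : ContinuousAt (fun z : A × L => P.e' (F z.1 z.2)) (a₀, q) := by
      refine ContinuousAt.comp (g := P.e') (f := Function.uncurry F) ?_ (hF q)
      exact P.e'.continuousAt (by simpa [Function.uncurry, hF₀] using hsrc)
    have h2 : ContinuousAt (fun z : A × L => P.e' (G z.1 z.2)) (a₀, q) := by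
      refine ContinuousAt.comp (g := P.e') (f := Function.uncurry G) ?_ (hG q)
      exact P.e'.continuousAt (by simpa [Function.uncurry, hG₀] using hsrc)
    have hχ : ContinuousAt (fun z : A × L => P.χ z.2) (a₀, q) :=
      P.smooth_χ.continuous.continuousAt.comp continuousAt_snd
    have h3 : ContinuousAt (fun z : A × L =>
        (1 - P.χ z.2) • P.e' (F z.1 z.2) + P.χ z.2 • P.e' (G z.1 z.2)) (a₀, q) :=
      ((continuousAt_const.sub hχ).smul h1).add (hχ.smul h2)
    have hv3 : (1 - P.χ q) • P.e' (F a₀ q) + P.χ q • P.e' (G a₀ q) = P.e' (u q) := by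
      rw [hF₀, hG₀, ← add_smul]; simp
    have h4 : ContinuousAt (fun z : A × L => P.e'.symm
        ((1 - P.χ z.2) • P.e' (F z.1 z.2) + P.χ z.2 • P.e' (G z.1 z.2))) (a₀, q) := by
      refine ContinuousAt.comp (g := P.e'.symm) ?_ h3
      simp only [hv3]
      exact P.e'.continuousAt_symm (P.e'.map_source hsrc)
    have hv4 : P.e'.symm ((1 - P.χ q) • P.e' (F a₀ q) + P.χ q • P.e' (G a₀ q)) = u q := by
      rw [hv3, P.e'.left_inv hsrc]
    -- The two branches have the same limit `u q`, so near `(a₀, q)` both lie in `W`, whichever of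
    -- them defines the deformation.
    intro W hW
    simp only [Function.uncurry, hval] at hW
    have h5 := h4 (show W ∈ 𝓝 _ by simpa only [hv4] using hW)
    have h6 := hF q (show W ∈ 𝓝 _ by simpa only [Function.uncurry, hF₀] using hW)
    rw [mem_map] at h5 h6 ⊢
    filter_upwards [h5, h6] with z hz5 hz6
    simp only [mem_preimage, Function.uncurry] at hz5 hz6 ⊢
    unfold Patch.deform
    split_ifs
    · exact hz5
    · exact hz6
  · refine (hF q).congr ?_
    have : ∀ᶠ z : A × L in 𝓝 (a₀, q), z.2 ∈ (P.e.symm '' P.K)ᶜ :=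
      continuousAt_snd.eventually (P.isClosed_support.isOpen_compl.mem_nhds hK)
    filter_upwards [this] with z hz
    exact (P.deform_of_notMem _ _ hz).symm

end Patches

/-! ### Local constancy of the integral of `f φ` in families of maps. -/

section LocalConstancy

open Topology Filter

variable {n : ℕ} {E : Type*} [NormedAddCommGroup E] [NormedSpace ℂ E]
  {M : Type*} [TopologicalSpace M] [ChartedSpace E M]
  {L : Type*} [TopologicalSpace L] [ChartedSpace (EuclideanSpace ℝ (Fin n)) L]
  {X : CalabiYau n E M} {U : Set M} {c : M → ℝ} {f : M → ℂ}

variable [T2Space L] [CompactSpace L] [IsManifold (𝓡 n) ∞ L] [MeasurableSpace L] [BorelSpace L]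

/-- Families of maps near `u` over which the integral of `f φ` is constant. -/
structure IsConstantFamily (u : SLagEmbedding X L U) (c : M → ℝ) (f : M → ℂ) {A : Type*}
    [TopologicalSpace A] (a₀ : A) (F : A → L → M) : Prop where
  base : F a₀ = u.toMap
  continuousAt : ∀ q, ContinuousAt (Function.uncurry F) (a₀, q)
  smooth : ∀ᶠ a in 𝓝 a₀, ContMDiff (𝓡 n) 𝓘(ℝ, E) ∞ (F a)
  mem : ∀ᶠ a in 𝓝 a₀, ∀ q, F a q ∈ U
  integral_eq : ∀ᶠ a in 𝓝 a₀,
    ∫ q, relativeIntegrand X f u.toMap (F a) q ∂(riemannianVolume (u.inducedMetric c)) =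
      ∫ q, relativeIntegrand X f u.toMap u.toMap q ∂(riemannianVolume (u.inducedMetric c))

theorem IsConstantFamily.deform [FiniteDimensional ℂ E]
    (hE : Module.finrank ℂ E = n) [IsManifold 𝓘(ℂ, E) ω M] (hc : X.IsNormalizing c)
    (hf : ContMDiffOn 𝓘(ℂ, E) 𝓘(ℂ, ℂ) ω f U) {u : SLagEmbedding X L U} {A : Type*}
    [TopologicalSpace A] {a₀ : A} {F G : A → L → M} (hF : IsConstantFamily u c f a₀ F)
    (hG₀ : G a₀ = u.toMap) (hG : ∀ q, ContinuousAt (Function.uncurry G) (a₀, q))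
    (hGs : ∀ a, ContMDiff (𝓡 n) 𝓘(ℝ, E) ∞ (G a)) (P : Patch (E := E) n u.toMap U) :
    IsConstantFamily u c f a₀ (fun a => P.deform (F a) (G a)) where
  base := by rw [hF.base, hG₀, P.deform_self]
  continuousAt := P.continuousAt_deform hF.base hG₀ hF.continuousAt hG
  smooth := by
    filter_upwards [hF.smooth, P.eventually_admissible hF.base hF.continuousAt,
      P.eventually_admissible hG₀ hG] with a ha hFa hGa
    exact P.contMDiff_deform hFa hGa ha (hGs a)
  mem := by
    filter_upwards [hF.mem, P.eventually_admissible hF.base hF.continuousAt,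
      P.eventually_admissible hG₀ hG] with a ha hFa hGa
    exact P.deform_mem hFa hGa ha
  integral_eq := by
    filter_upwards [hF.mem, P.eventually_admissible hF.base hF.continuousAt,
      P.eventually_admissible hG₀ hG, hF.smooth, hF.integral_eq] with a hU hFa hGa hs hI
    rw [← hI]
    have hdef := P.admissible_deform hFa hGa
    exact integral_relativeIntegrand_eq_of_deformation hE hc hf u hs
      (P.contMDiff_deform hFa hGa hs (hGs a)) hU (P.deform_mem hFa hGa hU) P.isSmoothChart
      P.mem_atlas P.isOpen_B P.convex_B P.B_subset P.mapsTo_B P.isOpen_V P.isPreconnected_V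
      P.V_subset P.isCompact_K P.K_subset (fun x hx => hFa _ (P.V_subset_C hx))
      (fun x hx => hdef _ (P.V_subset_C hx)) (fun q hq => P.deform_of_notMem _ _ hq)

/-- Induction on the list of patches, starting from the constant family `u`: each patch moves the
family onto `G` where its cutoff is `1`, keeping the integral and the points already moved. How near
`a` must be to `a₀` depends on the finite list. -/
theorem exists_isConstantFamily [FiniteDimensional ℂ E]
    (hE : Module.finrank ℂ E = n) [IsManifold 𝓘(ℂ, E) ω M] (hc : X.IsNormalizing c)
    (hf : ContMDiffOn 𝓘(ℂ, E) 𝓘(ℂ, ℂ) ω f U) {u : SLagEmbedding X L U} {A : Type*}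
    [TopologicalSpace A] {a₀ : A} {G : A → L → M}
    (hG₀ : G a₀ = u.toMap) (hG : ∀ q, ContinuousAt (Function.uncurry G) (a₀, q))
    (hGs : ∀ a, ContMDiff (𝓡 n) 𝓘(ℝ, E) ∞ (G a)) (l : List (Patch (E := E) n u.toMap U)) :
    ∃ F : A → L → M, IsConstantFamily u c f a₀ F ∧
      ∀ᶠ a in 𝓝 a₀, ∀ q, (∃ P ∈ l, P.χ q = 1) → F a q = G a q := by
  induction l with
  | nil =>
    refine ⟨fun _ => u.toMap, ⟨rfl, fun q => ?_, ?_, ?_, ?_⟩, by simp⟩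
    · exact u.toMap.contMDiff.continuous.continuousAt.comp continuousAt_snd
    · exact Eventually.of_forall fun _ => u.toMap.contMDiff
    · exact Eventually.of_forall fun _ q => u.range_subset ⟨q, rfl⟩
    · exact Eventually.of_forall fun _ => rfl
  | cons P l ih =>
    obtain ⟨F, hF, hFG⟩ := ih
    refine ⟨_, hF.deform hE hc hf hG₀ hG hGs P, ?_⟩
    filter_upwards [hFG, P.eventually_admissible hF.base hF.continuousAt,
      P.eventually_admissible hG₀ hG] with a ha hFa hGa q hq
    refine P.deform_eq_right hFa hGa ?_
    obtain ⟨Q, hQ, hQq⟩ := hq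
    rcases List.mem_cons.1 hQ with rfl | hQ
    · exact Or.inr hQq
    · exact Or.inl (ha q ⟨Q, hQ, hQq⟩)

/-- The integral of the closed form `f φ` is locally constant in families of maps. -/
theorem eventually_integral_relativeIntegrand_eq [FiniteDimensional ℂ E]
    (hE : Module.finrank ℂ E = n) [IsManifold 𝓘(ℂ, E) ω M] (hc : X.IsNormalizing c)
    (hU : IsOpen U) (hf : ContMDiffOn 𝓘(ℂ, E) 𝓘(ℂ, ℂ) ω f U) {u : SLagEmbedding X L U}
    {A : Type*} [TopologicalSpace A] {a₀ : A} {G : A → L → M}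
    (hG₀ : G a₀ = u.toMap) (hG : ∀ q, ContinuousAt (Function.uncurry G) (a₀, q))
    (hGs : ∀ a, ContMDiff (𝓡 n) 𝓘(ℝ, E) ∞ (G a)) :
    ∀ᶠ a in 𝓝 a₀,
      ∫ q, relativeIntegrand X f u.toMap (G a) q ∂(riemannianVolume (u.inducedMetric c)) =
      ∫ q, relativeIntegrand X f u.toMap u.toMap q ∂(riemannianVolume (u.inducedMetric c)) := by
  choose P hP using exists_patch (E := E) (n := n) u.toMap.contMDiff.continuous hU
    (fun q => u.range_subset ⟨q, rfl⟩)
  -- Finitely many sets where a cutoff equals `1` cover `L`, so after all these patches the family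
  -- coincides with `G`.
  obtain ⟨s, -, hs⟩ := isCompact_univ.elim_nhds_subcover
    (fun q => {q' | (P q).χ q' = 1}) (fun q _ => hP q)
  obtain ⟨F, hF, hFG⟩ := exists_isConstantFamily hE hc hf hG₀ hG hGs (s.toList.map P)
  filter_upwards [hF.integral_eq, hFG] with a hI hFGa
  have : F a = G a := by
    funext q
    obtain ⟨p, hp, hpq⟩ := mem_iUnion₂.1 (hs (mem_univ q))
    exact hFGa q ⟨P p, List.mem_map.2 ⟨p, Finset.mem_toList.2 hp, rfl⟩, hpq⟩
  rw [← this, hI]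

end LocalConstancy

/-! ### Consequences of closeness in the `C^∞` topology. -/

section Closeness

open Topology Filter

variable {n : ℕ} {E : Type*} [NormedAddCommGroup E] [NormedSpace ℂ E]
  {M : Type*} [TopologicalSpace M] [ChartedSpace E M]
  {L : Type*} [TopologicalSpace L] [ChartedSpace (EuclideanSpace ℝ (Fin n)) L]
  {X : CalabiYau n E M} {U : Set M} {c : M → ℝ} {f : M → ℂ}

theorem norm_frame_sub_le (g h : EuclideanSpace ℝ (Fin n) → E) (x : EuclideanSpace ℝ (Fin n))
    (k : Fin n) : ‖frame g x k - frame h x k‖ ≤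
      ‖iteratedFDeriv ℝ 1 g x - iteratedFDeriv ℝ 1 h x‖ := by
  have := (iteratedFDeriv ℝ 1 g x - iteratedFDeriv ℝ 1 h x).le_opNorm (fun _ => coordVec k)
  simpa [frame, iteratedFDeriv_one_apply] using this

/-- Joint continuity from locally uniform closeness to the reference map: the form in which the
`C^∞` topology delivers its estimates. -/
theorem continuousAt_of_norm_sub_lt {A Y Z : Type*} [TopologicalSpace A] [TopologicalSpace Y]
    [NormedAddCommGroup Z] {Φ : A × Y → Z} {a₀ : A} {y₀ : Y}
    (h0 : ContinuousAt (fun y => Φ (a₀, y)) y₀)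
    (h : ∀ ε > 0, ∀ᶠ z in 𝓝 (a₀, y₀), ‖Φ z - Φ (a₀, z.2)‖ < ε) : ContinuousAt Φ (a₀, y₀) := by
  have h1 : Tendsto (fun z : A × Y => Φ z - Φ (a₀, z.2)) (𝓝 (a₀, y₀)) (𝓝 0) := by
    rw [Metric.tendsto_nhds]
    intro ε hε
    simpa [dist_zero_right] using h ε hε
  have h2 : Tendsto (fun z : A × Y => Φ (a₀, z.2)) (𝓝 (a₀, y₀)) (𝓝 (Φ (a₀, y₀))) :=
    ContinuousAt.comp (x := (a₀, y₀)) (g := fun y => Φ (a₀, y)) h0 continuousAt_snd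
  have h3 := h1.add h2
  simpa [ContinuousAt] using h3

theorem SLagEmbedding.eventually_close [T2Space L] [CompactSpace L] (u : SLagEmbedding X L U)
    {e : OpenPartialHomeomorph L (EuclideanSpace ℝ (Fin n))}
    (he : e ∈ atlas (EuclideanSpace ℝ (Fin n)) L) {e' : OpenPartialHomeomorph M E}
    (he' : e' ∈ atlas E M) {q₀ : L} (hq₀ : q₀ ∈ e.source) (huq₀ : u.toMap q₀ ∈ e'.source)
    {ε : ℝ} (hε : 0 < ε) :
    ∀ᶠ z : SLagEmbedding X L U × L in 𝓝 (u, q₀), z.2 ∈ e.source ∧ z.1.toMap z.2 ∈ e'.source ∧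
      ‖e' (z.1.toMap z.2) - e' (u.toMap z.2)‖ < ε ∧
      ∀ k, ‖frame (e' ∘ z.1.toMap ∘ e.symm) (e z.2) k -
        frame (e' ∘ u.toMap ∘ e.symm) (e z.2) k‖ < ε := by
  obtain ⟨K, hK, hKsub, hKc⟩ := local_compact_nhds
    ((e.open_source.inter (e'.open_source.preimage u.toMap.contMDiff.continuous)).mem_nhds
      ⟨hq₀, huq₀⟩)
  have hKe : K ⊆ e.source := fun q hq => (hKsub hq).1
  have hKe' : MapsTo u.toMap K e'.source := fun q hq => (hKsub hq).2
  -- A subbasic neighbourhood of order `1` is enough: order `0` controls the map and order `1` its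
  -- frame.
  set N : Set C^∞⟮𝓡 n, L; 𝓘(ℝ, E), M⟯ := {h | MapsTo h K e'.source ∧ ∀ m ≤ 1, ∀ q ∈ K,
        ‖iteratedFDeriv ℝ m (e' ∘ h ∘ e.symm) (e q)
          - iteratedFDeriv ℝ m (e' ∘ u.toMap ∘ e.symm) (e q)‖ < ε} with hN
  have hNo : IsOpen[smoothTopology n E M L] N :=
    TopologicalSpace.isOpen_generateFrom_of_mem
      ⟨u.toMap, e, he, e', he', K, 1, ε, hε, hKc, hKe, hKe', rfl⟩
  have hNu : u.toMap ∈ N := ⟨hKe', fun m _ q _ => by simpa using hε⟩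
  have hopen : IsOpen (SLagEmbedding.toMap ⁻¹' N : Set (SLagEmbedding X L U)) :=
    ⟨N, hNo, rfl⟩
  have h1 : ∀ᶠ a in 𝓝 u, a.toMap ∈ N := hopen.mem_nhds hNu
  rw [nhds_prod_eq]
  filter_upwards [h1.prod_mk hK] with z hz
  obtain ⟨⟨hz1, hz2⟩, hz3⟩ := hz
  refine ⟨hKe hz3, hz1 hz3, ?_, fun k => ?_⟩
  · have := hz2 0 zero_le_one z.2 hz3
    rw [iteratedFDeriv_zero_eq_comp, iteratedFDeriv_zero_eq_comp] at this
    simp only [Function.comp_apply, ← map_sub, LinearIsometryEquiv.norm_map,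
      e.left_inv (hKe hz3)] at this
    exact this
  · exact (norm_frame_sub_le _ _ _ k).trans_lt (hz2 1 le_rfl z.2 hz3)

theorem SLagEmbedding.continuousAt_toMap [T2Space L] [CompactSpace L]
    (u : SLagEmbedding X L U) (q₀ : L) :
    ContinuousAt (Function.uncurry fun (a : SLagEmbedding X L U) q => a.toMap q) (u, q₀) := by
  set e := chartAt (EuclideanSpace ℝ (Fin n)) q₀
  set e' := chartAt E (u.toMap q₀)
  have he : e ∈ atlas (EuclideanSpace ℝ (Fin n)) L := chart_mem_atlas _ _
  have he' : e' ∈ atlas E M := chart_mem_atlas _ _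
  have hq₀ : q₀ ∈ e.source := mem_chart_source _ _
  have huq₀ : u.toMap q₀ ∈ e'.source := mem_chart_source _ _
  have h1 : ContinuousAt (fun z : SLagEmbedding X L U × L => e' (z.1.toMap z.2)) (u, q₀) := by
    refine continuousAt_of_norm_sub_lt ?_ fun ε hε => ?_
    · exact (e'.continuousAt huq₀).comp u.toMap.contMDiff.continuous.continuousAt
    · filter_upwards [u.eventually_close he he' hq₀ huq₀ hε] with z hz using hz.2.2.1
  have h2 : ContinuousAt (fun z : SLagEmbedding X L U × L => e'.symm (e' (z.1.toMap z.2)))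
      (u, q₀) :=
    ContinuousAt.comp (g := e'.symm) (e'.continuousAt_symm (e'.map_source huq₀)) h1
  refine h2.congr ?_
  filter_upwards [u.eventually_close he he' hq₀ huq₀ zero_lt_one] with z hz
  exact e'.left_inv hz.2.1

/-- The quotient equals `1` at `a = u`. Written with `pull` in charts, it is continuous at each `(u,
q)` jointly in the embedding and the point, and compactness of `L` makes positivity uniform. -/
theorem SLagEmbedding.eventually_ratio_pos [FiniteDimensional ℂ E]
    (hE : Module.finrank ℂ E = n) [IsManifold 𝓘(ℂ, E) ω M] [T2Space L] [CompactSpace L]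
    [IsManifold (𝓡 n) ∞ L] (u : SLagEmbedding X L U) :
    ∀ᶠ a : SLagEmbedding X L U in 𝓝 u, ∀ q,
      0 < (pullAt X a.toMap q / pullAt X u.toMap q).re := by
  suffices h : ∀ᶠ a : SLagEmbedding X L U in 𝓝 u, ∀ q ∈ (univ : Set L),
      0 < (pullAt X a.toMap q / pullAt X u.toMap q).re by
    filter_upwards [h] with a ha q using ha q (mem_univ q)
  refine isCompact_univ.eventually_forall_of_forall_eventually fun q₀ _ => ?_
  set e := chartAt (EuclideanSpace ℝ (Fin n)) q₀
  set e' := chartAt E (u.toMap q₀)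
  have he : e ∈ atlas (EuclideanSpace ℝ (Fin n)) L := chart_mem_atlas _ _
  have hes : IsSmoothChart e := isSmoothChart_of_mem_atlas he
  have he' : e' ∈ atlas E M := chart_mem_atlas _ _
  have hq₀ : q₀ ∈ e.source := mem_chart_source _ _
  have huq₀ : u.toMap q₀ ∈ e'.source := mem_chart_source _ _
  have hsm := contDiffAt_inCharts u.toMap.contMDiff hes he' (e.map_source hq₀)
    (by rwa [e.left_inv hq₀])
  have h1 : ContinuousAt (fun z : SLagEmbedding X L U × L => e' (z.1.toMap z.2)) (u, q₀) := by
    refine continuousAt_of_norm_sub_lt ?_ fun ε hε => ?_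
    · exact (e'.continuousAt huq₀).comp u.toMap.contMDiff.continuous.continuousAt
    · filter_upwards [u.eventually_close he he' hq₀ huq₀ hε] with z hz using hz.2.2.1
  have h2 : ContinuousAt (fun z : SLagEmbedding X L U × L =>
      frame (e' ∘ z.1.toMap ∘ e.symm) (e z.2)) (u, q₀) := by
    refine continuousAt_pi.2 fun k => continuousAt_of_norm_sub_lt ?_ fun ε hε => ?_
    · have h3 : ContinuousAt (fun x => frame (e' ∘ u.toMap ∘ e.symm) x k) (e q₀) :=
        continuousAt_pi.1
          (contDiffAt_frame (by exact_mod_cast contDiffAt_infty.1 hsm 2)).continuousAt k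
      exact ContinuousAt.comp (f := e) h3 (e.continuousAt hq₀)
    · filter_upwards [u.eventually_close he he' hq₀ huq₀ hε] with z hz using hz.2.2.2 k
  have hform : ContinuousAt (chartForm X.vol e') (e' (u.toMap q₀)) :=
    (X.vol_holomorphic e' he').continuousOn.continuousAt
      (e'.open_target.mem_nhds (e'.map_source huq₀))
  have hform' : ContinuousAt (fun z : SLagEmbedding X L U × L =>
      chartForm X.vol e' (e' (z.1.toMap z.2))) (u, q₀) :=
    ContinuousAt.comp (f := fun z : SLagEmbedding X L U × L => e' (z.1.toMap z.2))
      (x := (u, q₀)) hform h1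
  have h3 : ContinuousAt (fun z : SLagEmbedding X L U × L =>
      chartForm X.vol e' (e' (z.1.toMap z.2)) (frame (e' ∘ z.1.toMap ∘ e.symm) (e z.2)))
      (u, q₀) :=
    hform'.eval h2
  have hpull : ∀ (a : SLagEmbedding X L U) (q : L), q ∈ e.source → a.toMap q ∈ e'.source →
      pull X a.toMap e (e q) =
        chartForm X.vol e' (e' (a.toMap q)) (frame (e' ∘ a.toMap ∘ e.symm) (e q)) := by
    intro a q hq haq
    have := pull_eq_chartForm X a.toMap.contMDiff hes he' (e.map_source hq)
      (by rwa [e.left_inv hq])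
    simpa only [Function.comp_apply, e.left_inv hq] using this
  have h4 : ContinuousAt (fun z : SLagEmbedding X L U × L => pull X u.toMap e (e z.2)) (u, q₀) :=
    ContinuousAt.comp (g := fun q => pull X u.toMap e (e q)) (x := (u, q₀))
      (((continuousOn_pull X u.toMap.contMDiff hes).continuousAt
        (e.open_target.mem_nhds (e.map_source hq₀))).comp (e.continuousAt hq₀)) continuousAt_snd
  have hne := u.pull_ne_zero hE hes (e.map_source hq₀)
  have h5 := Complex.continuous_re.continuousAt.comp (h3.div h4 hne)
  have h6 := h5.eventually (lt_mem_nhds (a := 0) ?_)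
  · filter_upwards [h6, u.eventually_close he he' hq₀ huq₀ zero_lt_one] with z hz hz'
    have hx := e.map_source hz'.1
    have h7 := pull_eq_ratio_mul X z.1.toMap e (e z.2) (u := u.toMap)
      (u.pullAt_ne_zero hE _)
    rw [e.left_inv hz'.1] at h7
    simp only [Function.comp_apply, Pi.div_apply, ← hpull z.1 z.2 hz'.1 hz'.2.1] at hz
    rwa [h7, mul_div_cancel_right₀ _ (u.pull_ne_zero hE hes hx)] at hz
  · simp only [Function.comp_apply, Pi.div_apply, ← hpull u q₀ hq₀ huq₀]
    rw [div_self hne]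
    simp

variable [T2Space L] [CompactSpace L] [IsManifold (𝓡 n) ∞ L] [MeasurableSpace L] [BorelSpace L]

theorem SLagEmbedding.continuous_ratio [FiniteDimensional ℂ E]
    (hE : Module.finrank ℂ E = n) [IsManifold 𝓘(ℂ, E) ω M] (u a : SLagEmbedding X L U) :
    Continuous fun q => pullAt X a.toMap q / pullAt X u.toMap q := by
  -- With `f = 1` the relative integrand is the quotient itself.
  have := continuous_relativeIntegrand (f := fun _ => 1) (U := U) hE contMDiffOn_const u
    a.toMap.contMDiff (fun q => a.range_subset ⟨q, rfl⟩)
  exact this.congr fun q => by simp [relativeIntegrand]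

/-- In each chart both densities are the absolute values of the pullback coefficients, so the
Radon–Nikodym density is the modulus of their quotient. -/
theorem SLagEmbedding.riemannianVolume_eq_withDensity [FiniteDimensional ℂ E]
    (hE : Module.finrank ℂ E = n) [IsManifold 𝓘(ℂ, E) ω M] (hc : X.IsNormalizing c)
    (u a : SLagEmbedding X L U) :
    riemannianVolume (a.inducedMetric c) = (riemannianVolume (u.inducedMetric c)).withDensity
      fun q => ENNReal.ofReal ‖pullAt X a.toMap q / pullAt X u.toMap q‖ := by
  have hcont := u.continuous_ratio hE a
  have hw : Measurable fun q => ENNReal.ofReal ‖pullAt X a.toMap q / pullAt X u.toMap q‖ :=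
    hcont.norm.measurable.ennreal_ofReal
  refine measure_ext_of_charts (n := n) fun p => ?_
  set e := chartAt (EuclideanSpace ℝ (Fin n)) p
  have he : IsSmoothChart e := isSmoothChart_of_mem_atlas (chart_mem_atlas _ p)
  ext S hS
  have hSe : MeasurableSet (S ∩ e.source) := hS.inter e.open_source.measurableSet
  rw [Measure.restrict_apply hS, Measure.restrict_apply hS, withDensity_apply _ hSe,
    ← lintegral_indicator hSe, ← lintegral_indicator_one hSe,
    setLIntegral_riemannianVolume (a.hasContinuousDensity hc) he (measurable_one.indicator hSe)
      (fun q hq => by simp [hq]),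
    setLIntegral_riemannianVolume (u.hasContinuousDensity hc) he (hw.indicator hSe)
      (fun q hq => by simp [hq])]
  refine setLIntegral_congr_fun e.open_target.measurableSet fun x hx => ?_
  by_cases hxS : e.symm x ∈ S ∩ e.source
  · simp only [hxS, indicator_of_mem, Pi.one_apply, mul_one]
    rw [a.chartDensity_inducedMetric hc he hx, u.chartDensity_inducedMetric hc he hx,
      pull_eq_ratio_mul X a.toMap e x (u.pullAt_ne_zero hE (e.symm x)), norm_mul,
      ENNReal.ofReal_mul (norm_nonneg _), mul_comm]
  · simp only [hxS, indicator_of_notMem, not_false_eq_true, mul_zero]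

/-- Both pullbacks are real by the special condition, so a quotient with positive real part equals
its own modulus. Here the volume integral becomes an integral of `f φ`. -/
theorem SLagEmbedding.integral_eq_integral_relativeIntegrand [FiniteDimensional ℂ E]
    (hE : Module.finrank ℂ E = n) [IsManifold 𝓘(ℂ, E) ω M] (hc : X.IsNormalizing c)
    (f : M → ℂ) (u a : SLagEmbedding X L U)
    (ha : ∀ q, 0 < (pullAt X a.toMap q / pullAt X u.toMap q).re) :
    ∫ q, f (a.toMap q) ∂(riemannianVolume (a.inducedMetric c)) =
      ∫ q, relativeIntegrand X f u.toMap a.toMap q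
        ∂(riemannianVolume (u.inducedMetric c)) := by
  rw [u.riemannianVolume_eq_withDensity hE hc a,
    integral_withDensity_eq_integral_toReal_smul
      (u.continuous_ratio hE a).norm.measurable.ennreal_ofReal (by simp)]
  refine integral_congr_ae (Eventually.of_forall fun q => ?_)
  simp only
  rw [ENNReal.toReal_ofReal (norm_nonneg _), relativeIntegrand, mul_comm, Complex.real_smul]
  congr 1
  have him : (pullAt X a.toMap q / pullAt X u.toMap q).im = 0 := by
    simp [Complex.div_im, a.pullAt_im q, u.pullAt_im q]
  have hre : pullAt X a.toMap q / pullAt X u.toMap q =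
      ((pullAt X a.toMap q / pullAt X u.toMap q).re : ℂ) := Complex.ext rfl (by simp [him])
  conv_lhs => rw [hre]
  conv_rhs => rw [hre]
  rw [Complex.norm_real, Real.norm_eq_abs, abs_of_pos (ha q)]

theorem SLagEmbedding.eventually_integral_eq [FiniteDimensional ℂ E]
    (hE : Module.finrank ℂ E = n) [IsManifold 𝓘(ℂ, E) ω M] (hc : X.IsNormalizing c)
    (hU : IsOpen U) (hf : ContMDiffOn 𝓘(ℂ, E) 𝓘(ℂ, ℂ) ω f U) (u : SLagEmbedding X L U) :
    ∀ᶠ a : SLagEmbedding X L U in 𝓝 u,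
      ∫ q, f (a.toMap q) ∂(riemannianVolume (a.inducedMetric c)) =
        ∫ q, f (u.toMap q) ∂(riemannianVolume (u.inducedMetric c)) := by
  have h1 := eventually_integral_relativeIntegrand_eq hE hc hU hf (u := u)
    (G := fun (a : SLagEmbedding X L U) q => a.toMap q) rfl u.continuousAt_toMap
    (fun a => a.toMap.contMDiff)
  have h2 := u.eventually_ratio_pos hE
  have h3 := u.integral_eq_integral_relativeIntegrand hE hc f u h2.self_of_nhds
  filter_upwards [h1, h2] with a ha1 ha2
  rw [u.integral_eq_integral_relativeIntegrand hE hc f a ha2, h3]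
  exact ha1

end Closeness

end SLag

end

theorem theorem3p4p1 {n : ℕ} {E : Type*} [NormedAddCommGroup E] [NormedSpace ℂ E]
    [FiniteDimensional ℂ E] (hE : Module.finrank ℂ E = n)
    {M : Type*} [TopologicalSpace M] [T2Space M] [ChartedSpace E M] [IsManifold 𝓘(ℂ, E) ω M]
    (X : SLag.CalabiYau n E M) (c : M → ℝ) (hc : X.IsNormalizing c)
    {L : Type*} [TopologicalSpace L] [T2Space L] [CompactSpace L]
    [ChartedSpace (EuclideanSpace ℝ (Fin n)) L] [IsManifold (𝓡 n) ∞ L]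
    [MeasurableSpace L] [BorelSpace L]
    (U : Set M) (hU : IsOpen U) (f : M → ℂ) (hf : ContMDiffOn 𝓘(ℂ, E) 𝓘(ℂ, ℂ) ω f U)
    (i₀ : SLag.SLagEmbedding X L U) :
    (∀ i : SLag.SLagEmbedding X L U,
      Integrable (fun q => f (i.toMap q)) (SLag.riemannianVolume (i.inducedMetric c))) ∧
    ∀ i : SLag.SLagEmbedding X L U,
      (⟦i⟧ : SLag.Moduli L X U) ∈ connectedComponent (⟦i₀⟧ : SLag.Moduli L X U) →
      ∫ q, f (i.toMap q) ∂(SLag.riemannianVolume (i.inducedMetric c)) =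
        ∫ q, f (i₀.toMap q) ∂(SLag.riemannianVolume (i₀.inducedMetric c)) := by
  refine ⟨fun i => i.integrable_of_continuous hc (SLag.continuous_comp_of_forall_mem
    i.toMap.contMDiff.continuous (fun q => i.range_subset ⟨q, rfl⟩) hf), fun i hi => ?_⟩
  let ξ : SLag.Moduli L X U → ℂ := Quotient.lift
    (fun i : SLag.SLagEmbedding X L U =>
      ∫ q, f (i.toMap q) ∂(SLag.riemannianVolume (i.inducedMetric c)))
    -- Invariance under diffeomorphisms of `L` makes `ξ` well defined on the moduli space.
    fun i j ⟨ψ, hψ⟩ => (i.integral_reparametrization hc hf j ψ hψ).symm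
  have hξ : IsLocallyConstant ξ := by
    intro S
    -- Openness in the quotient topology is tested on embeddings, where local constancy is known.
    refine isOpen_coinduced.2 (isOpen_iff_mem_nhds.2 fun u hu => ?_)
    filter_upwards [u.eventually_integral_eq hE hc hU hf] with a ha
    change ∫ q, f (a.toMap q) ∂(SLag.riemannianVolume (a.inducedMetric c)) ∈ S
    rw [ha]
    exact hu
  exact hξ.apply_eq_of_isPreconnected isPreconnected_connectedComponent hi mem_connectedComponent
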